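/- Let $G$ be a real Lie group (finite-dimensional or, more generally, modelled on a Banach space) with Lie algebra $\mathfrak g=T_1G$, and let $k\ge 0$. For a smooth curve $c:\mathbb R\to G$ write $j^kc$ for its $k$-jet at $0$ and $\delta^rc=c'c^{-1}:\mathbb R\to\mathfrak g$ for its right logarithmic derivative. The jet group $J^kG$ is the set of all $j^kc$ with the multiplication $(j^kc)(j^kb)=j^k(cb)$. The $k$-th order tangent group is defined by $T^0G=G$ and $T^{k+1}G=T(T^kG)$, where the tangent bundle $TX$ of a Lie group $X$ carries the group structure obtained by applying the tangent functor to the operations of $X$. Let $I_k$ be the set of all subsets of $\{1,\dots,k\}$ and $I_k^*=I_k\setminus\{\emptyset\}$. Iterating the right trivialization $TX\cong X\times T_1X$, $T_gX\ni v\mapsto (g,v\cdot g^{-1})$, and the canonical splitting $T_1(TX)=T_1X\oplus\varepsilon\,T_1X$ into horizontal and vertical vectors, with the infinitesimal unit $\varepsilon_i$ recording the $i$-th step, one gets the right trivialization $$T^kG\;\cong\; G\times\bigoplus_{\alpha\in I_k^*}\varepsilon^\alpha\mathfrak g .$$ The symmetric group $S_k$ acts on the set $T^kG$ by permuting the infinitesimal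 units in the right trivialization: $$\sigma\cdot\bigl(g,(\varepsilon^\alpha x_\alpha)_{\alpha\in I_k^*}\bigr)=\bigl(g,(\varepsilon^{\sigma(\alpha)}x_\alpha)_{\alpha\in I_k^*}\bigr),\qquad \sigma\in S_k .$$ **Proposition.** The fixed-point set $(T^kG)^{S_k}$ is a subgroup of $T^kG$, and it is isomorphic to the jet group $J^kG$. More precisely, there is a group isomorphism $(T^kG)^{S_k}\to J^kG$ such that whenever it sends $(g,(\varepsilon^\alpha x_\alpha)_{\alpha\in I_k^*})$ to $j^kc$, one has $g=c(0)$ and $x_\alpha=(\delta^rc)^{(|\alpha|-1)}(0)$ for all $\alpha\in I_k^*$. This holds although the action is in general not by group automorphisms: if $k\ge2$ and the Lie bracket of $\mathfrak g$ is not identically zero, then there are $\sigma\in S_k$ and $u,v\in T^kG$ with $\sigma\cdot(uv)\ne(\sigma\cdot u)(\sigma\cdot v)$. -/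

import Mathlib

open scoped Manifold ContDiff

universe u

set_option linter.unusedSectionVars false

namespace HigherJets

/-! ### The tangent group of a Lie group -/

section TangentGroup

variable {E H G : Type u} [NormedAddCommGroup E] [NormedSpace ℝ E] [TopologicalSpace H]
  {I : ModelWithCorners ℝ E H} [TopologicalSpace G] [ChartedSpace H G] [Group G] [LieGroup I ∞ G]

/-- The group structure of `TG`: multiplication and inversion are the tangent maps of the
multiplication and inversion of `G` (with `T(G × G) = TG × TG`); the unit is `0 ∈ T_1 G`. -/
noncomputable instance tangentMul : Mul (TangentBundle I G) where
  mul p q := tangentMap (I.prod I) I (fun x : G × G => x.1 * x.2)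
    ((equivTangentBundleProd I G I G).symm (p, q))

noncomputable instance tangentOne : One (TangentBundle I G) where
  one := ⟨1, 0⟩

noncomputable instance tangentInv : Inv (TangentBundle I G) where
  inv p := tangentMap I I (fun x : G => x⁻¹) p

theorem tangentMul_def (p q : TangentBundle I G) :
    p * q = tangentMap (I.prod I) I (fun x : G × G => x.1 * x.2)
      ((equivTangentBundleProd I G I G).symm (p, q)) := rfl

theorem tangentInv_def (p : TangentBundle I G) :
    p⁻¹ = tangentMap I I (fun x : G => x⁻¹) p := rfl

theorem tangentOne_def : (1 : TangentBundle I G) = ⟨1, 0⟩ := rfl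

theorem mdifferentiable_mul :
    MDifferentiable (I.prod I) I (fun x : G × G => x.1 * x.2) :=
  (contMDiff_mul I ∞).mdifferentiable (by simp)

theorem mdifferentiable_inv : MDifferentiable I I (fun x : G => x⁻¹) :=
  (contMDiff_inv I ∞).mdifferentiable (by simp)

variable {E' H' N : Type*} [NormedAddCommGroup E'] [NormedSpace ℝ E'] [TopologicalSpace H']
  {J : ModelWithCorners ℝ E' H'} [TopologicalSpace N] [ChartedSpace H' N]

theorem tangentMap_mul {f g : N → G} (hf : MDifferentiable J I f) (hg : MDifferentiable J I g)
    (z : TangentBundle J N) :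
    tangentMap J I (fun x => f x * g x) z = tangentMap J I f z * tangentMap J I g z := by
  have h : (fun x => f x * g x) = (fun x : G × G => x.1 * x.2) ∘ (fun x => (f x, g x)) := rfl
  rw [h, tangentMap_comp_at _ (mdifferentiable_mul _) ((hf _).prodMk (hg _)), tangentMul_def]
  congr 1
  simp only [tangentMap, mfderiv_prodMk (hf _) (hg _)]
  rfl

theorem tangentMap_inv {f : N → G} (hf : MDifferentiable J I f) (z : TangentBundle J N) :
    tangentMap J I (fun x => (f x)⁻¹) z = (tangentMap J I f z)⁻¹ :=
  tangentMap_comp_at z (mdifferentiable_inv _) (hf _)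

theorem tangentMap_one (z : TangentBundle J N) :
    tangentMap J I (fun _ => (1 : G)) z = 1 := by
  simp only [tangentMap, mfderiv_const, tangentOne_def]
  rfl

noncomputable instance tangentGroup : Group (TangentBundle I G) where
  mul_assoc p q r := by
    let z : TangentBundle (I.prod (I.prod I)) (G × G × G) := ⟨(p.1, q.1, r.1), (p.2, q.2, r.2)⟩
    have h1 : MDifferentiable (I.prod (I.prod I)) I (fun x : G × G × G => x.1) :=
      mdifferentiable_fst
    have h2 : MDifferentiable (I.prod (I.prod I)) I (fun x : G × G × G => x.2.1) :=
      mdifferentiable_fst.comp mdifferentiable_snd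
    have h3 : MDifferentiable (I.prod (I.prod I)) I (fun x : G × G × G => x.2.2) :=
      mdifferentiable_snd.comp mdifferentiable_snd
    have h12 : MDifferentiable (I.prod (I.prod I)) I (fun x : G × G × G => x.1 * x.2.1) :=
      mdifferentiable_mul.comp (h1.prodMk h2)
    have h23 : MDifferentiable (I.prod (I.prod I)) I (fun x : G × G × G => x.2.1 * x.2.2) :=
      mdifferentiable_mul.comp (h2.prodMk h3)
    have e1 : tangentMap (I.prod (I.prod I)) I (fun x : G × G × G => x.1) z = p :=
      tangentMap_prodFst
    have e' : tangentMap (I.prod (I.prod I)) (I.prod I) (fun x : G × G × G => x.2) z =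
        ⟨(q.1, r.1), (q.2, r.2)⟩ := tangentMap_prodSnd
    have e2 : tangentMap (I.prod (I.prod I)) I (fun x : G × G × G => x.2.1) z = q := by
      refine (tangentMap_comp_at (I' := I.prod I) (f := Prod.snd) (g := Prod.fst) z
        mdifferentiableAt_fst mdifferentiableAt_snd).trans ?_
      refine (congrArg _ e').trans ?_
      exact tangentMap_prodFst
    have e3 : tangentMap (I.prod (I.prod I)) I (fun x : G × G × G => x.2.2) z = r := by
      refine (tangentMap_comp_at (I' := I.prod I) (f := Prod.snd) (g := Prod.snd) z
        mdifferentiableAt_snd mdifferentiableAt_snd).trans ?_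
      refine (congrArg _ e').trans ?_
      exact tangentMap_prodSnd
    have k1 := tangentMap_mul h12 h3 z
    have k2 := tangentMap_mul h1 h23 z
    rw [tangentMap_mul h1 h2 z] at k1
    rw [tangentMap_mul h2 h3 z] at k2
    rw [e1, e2, e3] at k1 k2
    rw [← k1, ← k2]
    congr 1
    funext x
    exact mul_assoc _ _ _
  one_mul p := by
    have h := tangentMap_mul (J := I) (I := I) (f := fun _ : G => 1) (g := id)
      mdifferentiable_const mdifferentiable_id p
    rw [tangentMap_one, tangentMap_id] at h
    exact h.symm.trans (by simp only [id, one_mul]; exact congrFun tangentMap_id p)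
  mul_one p := by
    have h := tangentMap_mul (J := I) (I := I) (g := fun _ : G => 1) (f := id)
      mdifferentiable_id mdifferentiable_const p
    rw [tangentMap_one, tangentMap_id] at h
    exact h.symm.trans (by simp only [id, mul_one]; exact congrFun tangentMap_id p)
  inv_mul_cancel p := by
    have h := tangentMap_mul (J := I) (I := I) (f := fun x : G => x⁻¹) (g := id)
      mdifferentiable_inv mdifferentiable_id p
    simpa [tangentMap_one, tangentMap_id, ← tangentInv_def] using h.symm

/-- `TG` is again a Lie group. -/
instance tangentLieGroup : LieGroup I.tangent ∞ (TangentBundle I G) where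
  contMDiff_mul :=
    ((contMDiff_mul I ∞ (G := G)).contMDiff_tangentMap (m := ∞) (by simp)).comp
      contMDiff_equivTangentBundleProd_symm
  contMDiff_inv := (contMDiff_inv I ∞ (G := G)).contMDiff_tangentMap (m := ∞) (by simp)

variable (I) in
/-- Right translation of a tangent vector `v ∈ T_g G` by `h`: the vector `v · h ∈ T_{gh} G`. -/
noncomputable def rightTranslate {g : G} (v : TangentSpace I g) (h : G) :
    TangentSpace I (g * h) :=
  mfderiv I I (fun x : G => x * h) g v

variable (I) in
theorem mk_rightTranslate {g : G} (v : TangentSpace I g) (h : G) :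
    (⟨g * h, rightTranslate I v h⟩ : TangentBundle I G) =
      tangentMap I I (fun x : G => x * h) ⟨g, v⟩ := rfl


theorem rightTranslate_rightTranslate {x y z : G} (v : TangentSpace I x) (a b : G)
    (hy : x * a = y) (hz : a * b = z) :
    (rightTranslate I (g := y) (rightTranslate I v a : E) b : E) =
      (rightTranslate I v z : E) := by
  subst hy hz
  have hd (h : G) : MDifferentiable I I (fun x : G => x * h) :=
    (contMDiff_mul_right (n := ∞)).mdifferentiable (by simp)
  have h := mfderiv_comp_apply (I := I) (I' := I) (I'' := I) (f := fun x : G => x * a)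
    (g := fun x : G => x * b) x (hd _ _) (hd _ _) v
  have e : (fun x : G => x * b) ∘ (fun x : G => x * a) = fun x => x * (a * b) := by
    funext x; exact mul_assoc _ _ _
  rw [e] at h
  exact h.symm

theorem rightTranslate_one {x : G} (v : TangentSpace I x) :
    (rightTranslate I v 1 : E) = v := by
  have e : (fun x : G => x * 1) = id := by funext x; exact mul_one x
  have h : mfderiv I I (fun x : G => x * 1) x = mfderiv I I id x := by rw [e]
  exact (congrArg (fun L : E →L[ℝ] E => L v) h).trans
    (congrArg (fun L : E →L[ℝ] E => L v) (mfderiv_id (I := I) (x := x)))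

variable (I G) in
/-- The right trivialization `TG ≃ G × 𝔤`, `v ↦ (g, v · g⁻¹)` for `v ∈ T_g G`. -/
noncomputable def rightTrivTangent : TangentBundle I G ≃ G × GroupLieAlgebra I G where
  toFun p := (p.1, rightTranslate I p.2 p.1⁻¹)
  invFun y := ⟨y.1, rightTranslate I (g := 1) y.2 y.1⟩
  left_inv p := congrArg (Bundle.TotalSpace.mk p.1)
    ((rightTranslate_rightTranslate p.2 p.1⁻¹ p.1 (mul_inv_cancel _) (inv_mul_cancel _)).trans
      (rightTranslate_one p.2))
  right_inv y := congrArg (Prod.mk y.1)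
    ((rightTranslate_rightTranslate (I := I) (x := (1 : G)) y.2 y.1 y.1⁻¹ (one_mul _)
      (mul_inv_cancel _)).trans (rightTranslate_one (I := I) (x := (1 : G)) y.2))

/-- Horizontal vectors at a zero vector: the derivative of the zero section is `a ↦ (a, 0)`. -/
theorem mfderiv_zeroSection_apply (g : G) (a : TangentSpace I g) :
    (mfderiv I I.tangent (fun x => (⟨x, 0⟩ : TangentBundle I G)) g a : E × E) = (a, 0) := by
  have h := TangentBundle.tangentMap_tangentBundle_pure (I := I) (M := G) ⟨g, a⟩
  have h2 := Bundle.TotalSpace.ext_iff.1 h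
  exact eq_of_heq h2.2

/-- Vertical vectors at a zero vector: the derivative of the inclusion of the fibre is
`b ↦ (0, b)`. -/
theorem mfderiv_fiber_apply (g : G) (b : E) :
    (mfderiv 𝓘(ℝ, E) I.tangent (fun v : E => (⟨g, v⟩ : TangentBundle I G)) 0 b : E × E) =
      (0, b) := by
  have ht (v : E) : trivializationAt E (TangentSpace I : G → Type _) g ⟨g, v⟩ = (g, v) :=
    Prod.ext rfl ((tangentBundleCore I G).coordChange_self (achart H g) g (mem_chart_source H g) v)
  have hw : writtenInExtChartAt 𝓘(ℝ, E) I.tangent 0 (fun v : E => (⟨g, v⟩ : TangentBundle I G)) =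
      fun v => (extChartAt I g g, v) := by
    funext v
    have h : extChartAt I.tangent (⟨g, 0⟩ : TangentBundle I G) ⟨g, v⟩ = (extChartAt I g g, v) := by
      rw [FiberBundle.extChartAt]
      change Prod.map (extChartAt I g) id
        (trivializationAt E (TangentSpace I : G → Type _) g ⟨g, v⟩) = _
      rw [ht]
      rfl
    exact h
  have hd : MDifferentiableAt 𝓘(ℝ, E) I.tangent
      (fun v : E => (⟨g, v⟩ : TangentBundle I G)) 0 := by
    refine ContMDiffAt.mdifferentiableAt (n := 1) ?_ (by simp)
    rw [Bundle.contMDiffAt_totalSpace]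
    refine ⟨contMDiffAt_const, ?_⟩
    simp only [ht]
    exact contMDiffAt_id
  rw [hd.mfderiv, hw]
  simp only [modelWithCornersSelf_coe, Set.range_id, fderivWithin_univ]
  have hF : HasFDerivAt (fun v : E => (extChartAt I g g, v))
      ((0 : E →L[ℝ] E).prod (ContinuousLinearMap.id ℝ E)) (extChartAt 𝓘(ℝ, E) (0 : E) 0) :=
    (hasFDerivAt_const _ _).prodMk (hasFDerivAt_id _)
  rw [hF.fderiv]
  rfl

end TangentGroup

/-! ### Iterated tangent groups -/

/-- A real Lie group together with its model, bundled in order to iterate the functor `T`. -/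
structure BundledLieGroup where
  E : Type u
  H : Type u
  G : Type u
  [normedAddCommGroup : NormedAddCommGroup E]
  [normedSpace : NormedSpace ℝ E]
  [topH : TopologicalSpace H]
  I : ModelWithCorners ℝ E H
  [topG : TopologicalSpace G]
  [charted : ChartedSpace H G]
  [group : Group G]
  [lieGroup : LieGroup I ∞ G]

namespace BundledLieGroup

attribute [instance] normedAddCommGroup normedSpace topH topG charted group lieGroup

/-- The tangent group `TX` of a Lie group `X`. -/
noncomputable def tangent (X : BundledLieGroup.{u}) : BundledLieGroup.{u} where
  E := X.E × X.E
  H := ModelProd X.H X.E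
  G := TangentBundle X.I X.G
  I := X.I.tangent

end BundledLieGroup

/-- Multi-indices: `Idx k` is the set `I_k` of all subsets of `{1, …, k}`. -/
abbrev Idx (k : ℕ) : Type := Finset (Fin k)

/-- `IdxStar k` is the set `I_k^*` of all nonempty subsets of `{1, …, k}`. -/
abbrev IdxStar (k : ℕ) : Type := {α : Idx k // α.Nonempty}

/-- `α ⊆ {1, …, k}` seen as a subset of `{1, …, k+1}`. -/
def Idx.up {k : ℕ} (α : Idx k) : Idx (k + 1) := α.map Fin.castSuccEmb

/-- `α ↦ α ∪ {k+1}`, from subsets of `{1, …, k}` to subsets of `{1, …, k+1}`. -/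
def Idx.add {k : ℕ} (α : Idx k) : Idx (k + 1) := insert (Fin.last k) α.up

/-- `α ↦ α ∩ {1, …, k}`, from subsets of `{1, …, k+1}` to subsets of `{1, …, k}`. -/
def Idx.down {k : ℕ} (α : Idx (k + 1)) : Idx k := Finset.univ.filter fun i => i.castSucc ∈ α

theorem Idx.last_notMem_up {k : ℕ} (α : Idx k) : Fin.last k ∉ α.up := by
  simp [Idx.up, Fin.castSucc_ne_last]

theorem Idx.down_up {k : ℕ} (α : Idx k) : α.up.down = α := by
  ext i; simp [Idx.up, Idx.down]

theorem Idx.down_add {k : ℕ} (α : Idx k) : α.add.down = α := by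
  ext i; simp [Idx.up, Idx.add, Idx.down, Fin.castSucc_ne_last]

theorem Idx.up_down {k : ℕ} {α : Idx (k + 1)} (h : Fin.last k ∉ α) : α.down.up = α := by
  ext i
  refine Fin.lastCases ?_ (fun i => ?_) i
  · simp [Idx.last_notMem_up, h]
  · simp [Idx.up, Idx.down]

theorem Idx.add_down {k : ℕ} {α : Idx (k + 1)} (h : Fin.last k ∈ α) : α.down.add = α := by
  ext i
  refine Fin.lastCases ?_ (fun i => ?_) i
  · simp [Idx.add, h]
  · simp [Idx.add, Idx.up, Idx.down, Fin.castSucc_ne_last]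

theorem Idx.up_nonempty {k : ℕ} {α : Idx k} (h : α.Nonempty) : α.up.Nonempty := by
  simpa [Idx.up] using h

theorem Idx.add_nonempty {k : ℕ} (α : Idx k) : α.add.Nonempty :=
  ⟨_, Finset.mem_insert_self _ _⟩

theorem Idx.down_nonempty {k : ℕ} {α : Idx (k + 1)} (h : Fin.last k ∉ α) (hα : α.Nonempty) :
    α.down.Nonempty := by
  rw [← Idx.up_down h] at hα
  simpa [Idx.up] using hα

/-- `⨁_{α ∈ I_k} V ⊕ ε_{k+1} ⨁_{α ∈ I_k} V = ⨁_{α ∈ I_{k+1}} V`. -/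
def glue {V : Type*} [AddCommGroup V] [Module ℝ V] (k : ℕ) :
    ((Idx k → V) × (Idx k → V)) ≃ₗ[ℝ] (Idx (k + 1) → V) where
  toFun f α := if Fin.last k ∈ α then f.2 α.down else f.1 α.down
  invFun f := (fun α => f α.up, fun α => f α.add)
  map_add' f g := by ext α; by_cases h : Fin.last k ∈ α <;> simp [h]
  map_smul' r f := by ext α; by_cases h : Fin.last k ∈ α <;> simp [h]
  left_inv f := by
    ext α
    · simp [Idx.last_notMem_up, Idx.down_up]
    · simp [Idx.add, show (insert (Fin.last k) α.up).down = α from Idx.down_add α]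
  right_inv f := by
    ext α; by_cases h : Fin.last k ∈ α
    · simp [h, Idx.add_down h]
    · simp [h, Idx.up_down h]

/-- `⨁_{α ∈ I_k^*} V ⊕ ε_{k+1} ⨁_{α ∈ I_k} V = ⨁_{α ∈ I_{k+1}^*} V`. -/
def glueStar {V : Type*} (k : ℕ) :
    ((IdxStar k → V) × (Idx k → V)) ≃ (IdxStar (k + 1) → V) where
  toFun f α := if h : Fin.last k ∈ α.1 then f.2 α.1.down
    else f.1 ⟨α.1.down, Idx.down_nonempty h α.2⟩
  invFun f := (fun α => f ⟨α.1.up, Idx.up_nonempty α.2⟩, fun α => f ⟨α.add, Idx.add_nonempty α⟩)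
  left_inv f := by
    ext α
    · simp [Idx.last_notMem_up, Idx.down_up]
    · simp [Idx.add, show (insert (Fin.last k) α.up).down = α from Idx.down_add α]
  right_inv f := by
    ext α; by_cases h : Fin.last k ∈ α.1
    · simp [h, Idx.add_down h]
    · simp [h, Idx.up_down h]

/-- The effect `α ↦ σ(α)` of a permutation of `{1, …, k}` on `I_k^*`. -/
def permIdx {k : ℕ} (σ : Equiv.Perm (Fin k)) (α : IdxStar k) : IdxStar k :=
  ⟨α.1.map σ.toEmbedding, α.2.map⟩

theorem permIdx_one {k : ℕ} (α : IdxStar k) : permIdx 1 α = α := by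
  apply Subtype.ext; exact Finset.map_refl

theorem permIdx_mul {k : ℕ} (σ τ : Equiv.Perm (Fin k)) (α : IdxStar k) :
    permIdx (σ * τ) α = permIdx σ (permIdx τ α) := by
  apply Subtype.ext
  exact (Finset.map_map τ.toEmbedding σ.toEmbedding α.1).symm

/-- The action of `S_k` on `G × ⨁_{α ∈ I_k^*} ε^α 𝔤` by permutation of the infinitesimal units:
`σ · (g, ∑ ε^α x_α) = (g, ∑ ε^{σ(α)} x_α)`, so that the coefficient of `ε^β` in the result is
`x_{σ⁻¹(β)}`. -/
def permUnits {X V : Type*} {k : ℕ} (σ : Equiv.Perm (Fin k)) (y : X × (IdxStar k → V)) :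
    X × (IdxStar k → V) :=
  (y.1, fun β => y.2 (permIdx σ⁻¹ β))

section Tower

variable {E H : Type u} [NormedAddCommGroup E] [NormedSpace ℝ E] [TopologicalSpace H]
  (I : ModelWithCorners ℝ E H) (G : Type u) [TopologicalSpace G] [ChartedSpace H G] [Group G]
  [LieGroup I ∞ G]

/-- `T^0 G = G`, `T^{k+1} G = T(T^k G)`, as Lie groups. -/
noncomputable def tower : ℕ → BundledLieGroup.{u}
  | 0 => { E := E, H := H, G := G, I := I }
  | k + 1 => (tower k).tangent

/-- The `k`-th order tangent group `T^k G`. -/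
abbrev HigherTangent (k : ℕ) : Type u := (tower I G k).G

/-- The Lie algebra `T^k 𝔤 = T_1(T^k G)` of `T^k G` as the vector space
`⨁_{α ∈ I_k} ε^α 𝔤`. At each step one uses the canonical splitting
`T_1(TX) = T_1 X ⊕ ε T_1 X` of the tangent space of `TX` at the zero vector `1 = 0 ∈ T_1 X` into
horizontal vectors (tangent to the zero section) and vertical vectors (tangent to the fibre).
In Mathlib's model of the tangent bundle it is the identity of `E × E`; see
`mfderiv_zeroSection_apply` and `mfderiv_fiber_apply`. -/
noncomputable def lieAlgebraSplit :
    (k : ℕ) → GroupLieAlgebra (tower I G k).I (tower I G k).G ≃ₗ[ℝ]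
      (Idx k → GroupLieAlgebra I G)
  | 0 => (LinearEquiv.funUnique (Idx 0) ℝ (GroupLieAlgebra I G)).symm
  | k + 1 => ((lieAlgebraSplit k).prodCongr (lieAlgebraSplit k)).trans (glue k)

/-- The right trivialization `T^k G ≃ G × ⨁_{α ∈ I_k^*} ε^α 𝔤`, obtained by iterating
`T^{k+1} G = T(T^k G) ≃ T^k G × ε_{k+1} T^k 𝔤`. -/
noncomputable def rightTriv :
    (k : ℕ) → HigherTangent I G k ≃ G × (IdxStar k → GroupLieAlgebra I G)
  | 0 =>
    { toFun := fun g => (g, fun _ => 0)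
      invFun := fun y => y.1
      left_inv := fun _ => rfl
      right_inv := fun y => Prod.ext rfl (funext fun α => by
        obtain ⟨i, -⟩ := α.2
        exact i.elim0) }
  | k + 1 =>
    (rightTrivTangent (I := (tower I G k).I) (G := (tower I G k).G)).trans <|
      ((rightTriv k).prodCongr (lieAlgebraSplit I G k).toEquiv).trans <|
        (Equiv.prodAssoc _ _ _).trans ((Equiv.refl G).prodCongr (glueStar k))

/-- The action of `S_k` on `T^k G` by permutation of the infinitesimal units in the right
trivialization. -/
noncomputable instance permAction (k : ℕ) :
    MulAction (Equiv.Perm (Fin k)) (HigherTangent I G k) where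
  smul σ u := (rightTriv I G k).symm (permUnits σ (rightTriv I G k u))
  one_smul u := by
    change (rightTriv I G k).symm (permUnits 1 (rightTriv I G k u)) = u
    simp [permUnits, permIdx_one]
  mul_smul σ τ u := by
    change (rightTriv I G k).symm (permUnits (σ * τ) (rightTriv I G k u)) =
      (rightTriv I G k).symm (permUnits σ (rightTriv I G k
        ((rightTriv I G k).symm (permUnits τ (rightTriv I G k u)))))
    simp [permUnits, permIdx_mul]

end Tower

/-! ### Jet groups -/

section Jets

variable {E H : Type u} [NormedAddCommGroup E] [NormedSpace ℝ E] [TopologicalSpace H]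
  (I : ModelWithCorners ℝ E H) (G : Type u) [TopologicalSpace G] [ChartedSpace H G] [Group G]
  [LieGroup I ∞ G]

/-- Smooth curves `ℝ → G`, a group under pointwise multiplication. -/
abbrev SmoothCurve : Type u := C^∞⟮𝓘(ℝ, ℝ), ℝ; I, G⟯

variable {G}

/-- Two smooth curves have the same `k`-jet at `0`: they have the same value at `0` and, in the
chart around this value, the same derivatives at `0` up to order `k`. -/
def SameJet (k : ℕ) (c b : SmoothCurve I G) : Prop :=
  c 0 = b 0 ∧ ∀ j ≤ k,
    iteratedDeriv j (fun t => extChartAt I (c 0) (c t)) 0 =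
      iteratedDeriv j (fun t => extChartAt I (c 0) (b t)) 0

theorem iteratedDeriv_comp_congr {F F' : Type*} [NormedAddCommGroup F] [NormedSpace ℝ F]
    [NormedAddCommGroup F'] [NormedSpace ℝ F'] {u v : ℝ → F} {f : F → F'} {k : ℕ}
    (hu : ContDiffAt ℝ ∞ u 0) (hv : ContDiffAt ℝ ∞ v 0) (hf : ContDiffAt ℝ ∞ f (u 0))
    (h : ∀ j ≤ k, iteratedFDeriv ℝ j u 0 = iteratedFDeriv ℝ j v 0) {j : ℕ} (hj : j ≤ k) :
    iteratedFDeriv ℝ j (f ∘ u) 0 = iteratedFDeriv ℝ j (f ∘ v) 0 := by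
  have h0 : u 0 = v 0 := by
    have := congrArg (fun L => L (fun _ => (0 : ℝ))) (h 0 (Nat.zero_le _))
    simpa using this
  have hj' : (j : WithTop ℕ∞) ≤ ∞ := by exact_mod_cast le_top
  rw [iteratedFDeriv_comp hf hu hj', iteratedFDeriv_comp (h0 ▸ hf) hv hj', ← h0]
  simp only [FormalMultilinearSeries.taylorComp]
  refine Finset.sum_congr rfl fun c _ => ?_
  simp only [FormalMultilinearSeries.compAlongOrderedFinpartition]
  congr 1
  funext i
  exact h _ ((c.partSize_le i).trans hj)

theorem iteratedFDeriv_eq_iff {F : Type*} [NormedAddCommGroup F] [NormedSpace ℝ F] {u v : ℝ → F}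
    {j : ℕ} : iteratedFDeriv ℝ j u 0 = iteratedFDeriv ℝ j v 0 ↔
      iteratedDeriv j u 0 = iteratedDeriv j v 0 := by
  rw [iteratedFDeriv_eq_equiv_comp, iteratedFDeriv_eq_equiv_comp]
  exact (ContinuousMultilinearMap.piFieldEquiv ℝ (Fin j) F).injective.eq_iff

theorem contDiffAt_chart (c : SmoothCurve I G) :
    ContDiffAt ℝ ∞ (fun t => extChartAt I (c 0) (c t)) 0 := by
  rw [← contMDiffAt_iff_contDiffAt]
  exact contMDiffAt_extChartAt.comp 0 c.contMDiff.contMDiffAt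

/-- The right logarithmic derivative `δʳc = c' c⁻¹ : ℝ → 𝔤` of a smooth curve. Here `𝔤 = T_1 G` is
the vector space `E`. -/
noncomputable def rightLogDeriv (c : SmoothCurve I G) : ℝ → E := fun t =>
  rightTranslate I (mfderiv 𝓘(ℝ, ℝ) I c t (1 : ℝ)) (c t)⁻¹

variable (G) [I.Boundaryless]

/-- Having the same `k`-jet at `0` is compatible with pointwise multiplication of curves. -/
noncomputable def jetCon (k : ℕ) : Con (SmoothCurve I G) where
  r := SameJet I k
  iseqv :=
    { refl := fun c => ⟨rfl, fun _ _ => rfl⟩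
      symm := fun {c b} h => ⟨h.1.symm, fun j hj => by rw [← h.1]; exact (h.2 j hj).symm⟩
      trans := fun {c b d} h h' => ⟨h.1.trans h'.1, fun j hj => by
        rw [h.2 j hj]
        have := h'.2 j hj
        rwa [← h.1] at this⟩ }
  mul' := by
    intro c c' b b' hc hb
    refine ⟨congrArg₂ (· * ·) hc.1 hb.1, fun j hj => ?_⟩
    set φ := extChartAt I (c 0) with hφ
    set ψ := extChartAt I (b 0) with hψ
    let f : E × E → E := fun z => extChartAt I (c 0 * b 0) (φ.symm z.1 * ψ.symm z.2)
    have hφc := contDiffAt_chart I c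
    have hψb := contDiffAt_chart I b
    have hφc' := contDiffAt_chart I c'
    have hψb' := contDiffAt_chart I b'
    rw [← hc.1] at hφc'
    rw [← hb.1] at hψb'
    have hf : ContDiffAt ℝ ∞ f (φ (c 0), ψ (b 0)) := by
      rw [← contMDiffAt_iff_contDiffAt]
      have s (x : G) : ContMDiffAt 𝓘(ℝ, E) I ∞ (extChartAt I x).symm (extChartAt I x x) :=
        (contMDiffOn_extChartAt_symm x).contMDiffAt (extChartAt_target_mem_nhds x)
      have s1 : ContMDiffAt 𝓘(ℝ, E × E) I ∞ (fun z : E × E => φ.symm z.1) (φ (c 0), ψ (b 0)) :=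
        (s (c 0)).comp (φ (c 0), ψ (b 0)) contDiff_fst.contDiffAt.contMDiffAt
      have s2 : ContMDiffAt 𝓘(ℝ, E × E) I ∞ (fun z : E × E => ψ.symm z.2) (φ (c 0), ψ (b 0)) :=
        (s (b 0)).comp (φ (c 0), ψ (b 0)) contDiff_snd.contDiffAt.contMDiffAt
      refine ContMDiffAt.comp_of_eq (I' := I) contMDiffAt_extChartAt (s1.mul s2) ?_
      simp [hφ, hψ]
    have key (p q : SmoothCurve I G) (hp : c 0 = p 0) (hq : b 0 = q 0) :
        (fun t => extChartAt I ((c * b) 0) ((p * q) t)) =ᶠ[nhds 0]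
          f ∘ (fun t => (φ (p t), ψ (q t))) := by
      have e1 : ∀ᶠ t in nhds (0 : ℝ), p t ∈ φ.source :=
        p.contMDiff.continuous.continuousAt.eventually_mem
          (by rw [← hp]; exact extChartAt_source_mem_nhds _)
      have e2 : ∀ᶠ t in nhds (0 : ℝ), q t ∈ ψ.source :=
        q.contMDiff.continuous.continuousAt.eventually_mem
          (by rw [← hq]; exact extChartAt_source_mem_nhds _)
      filter_upwards [e1, e2] with t h1 h2
      simp [f, φ.left_inv h1, ψ.left_inv h2]
    rw [(key c b rfl rfl).iteratedDeriv_eq, (key c' b' hc.1 hb.1).iteratedDeriv_eq,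
      ← iteratedFDeriv_eq_iff]
    refine iteratedDeriv_comp_congr (hφc.prodMk hψb) (hφc'.prodMk hψb') hf (fun i hi => ?_) hj
    have hi' : (i : WithTop ℕ∞) ≤ ∞ := by exact_mod_cast le_top
    rw [iteratedFDeriv_prodMk hφc hψb hi', iteratedFDeriv_prodMk hφc' hψb' hi',
      iteratedFDeriv_eq_iff.2 (hc.2 i hi), iteratedFDeriv_eq_iff.2 (hb.2 i hi)]

/-- The jet group `J^k G` of `k`-jets at `0` of smooth curves in `G`, with
`(j^k c)(j^k b) = j^k (c b)`. -/
abbrev JetGroup (k : ℕ) : Type u := (jetCon I G k).Quotient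

variable {G}

/-- The `k`-jet `j^k c` at `0` of a smooth curve `c`. -/
noncomputable def jet (k : ℕ) (c : SmoothCurve I G) : JetGroup I G k := (c : (jetCon I G k).Quotient)

end Jets

end HigherJets

open HigherJets

/-! A smooth curve c lifts to T^kG as t ↦ c(t + ε₁ + ⋯ + ε_k), by taking velocities k times. Taking
velocities respects pointwise products, so evaluation at 0 gives a homomorphism `jetTower` from
curves to T^kG. The first claim amounts to finding its image and its fibres; no product formula in
the right trivialization is needed.

Coordinates (`rightTriv_jetTower`). The logarithmic derivative of the velocity lift of c is the pair
(δc, (δc)'), by symmetry of mixed partial derivatives (`rightLogDeriv_liftCurve`). By induction the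
coefficient of ε^α in the lift of c is (δc)^(|α|-1). It depends only on |α|, and since S_k is
transitive on subsets of a given size, this dependence characterizes fixed points.

Image and fibres. In the chart at c(0), with p the chart expression of c, one has δc = A(p)p' with
A(p(0)) bijective. If p and q agree to order j, the j-th derivatives of A(p)p' and A(q)q' differ by
A(p(0)) applied to the difference of the (j+1)-st derivatives (`iteratedDeriv_coeff_sub`). This
triangular relation shows that the k-jet of c is equivalent to c(0) together with the derivatives of
δc of order below k (`sameJet_iff`), and that these data can be prescribed freely
(`exists_curve_rightLogDeriv`). Hence J^kG embeds in T^kG with the fixed-point set as range, and the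
range of a homomorphism is a subgroup.

Failure of multiplicativity. For k = 2 the product ε₂Y · ε₁X has coefficients X, Y and 0, so the
swap sends it to ε₂X · ε₁Y. If the swap were multiplicative on ε₁X · ε₂Y, then ε₁X and ε₂Y would
commute. In a chart at 1 this makes a mixed second derivative of the multiplication symmetric in X
and Y, that is, [X, Y] = 0. Zero sections carry a counterexample from k to k + 1. -/

namespace HigherJets

/-! ### Calculus of curves -/

section Calculus

variable {F F' : Type*} [NormedAddCommGroup F] [NormedSpace ℝ F]
  [NormedAddCommGroup F'] [NormedSpace ℝ F']

theorem natCast_le_infty (n : ℕ) : (n : WithTop ℕ∞) ≤ ∞ := by exact_mod_cast le_top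

theorem two_le_infty : (2 : WithTop ℕ∞) ≤ ∞ := natCast_le_infty 2

theorem deriv_slice_left {f : ℝ × ℝ → F} {z : ℝ × ℝ} (hf : DifferentiableAt ℝ f z) :
    HasDerivAt (fun s => f (s, z.2)) (fderiv ℝ f z (1, 0)) z.1 := by
  have h1 : HasDerivAt (fun s : ℝ => (s, z.2)) ((1 : ℝ), (0 : ℝ)) z.1 :=
    (hasDerivAt_id _).prodMk (hasDerivAt_const _ _)
  exact HasFDerivAt.comp_hasDerivAt (f := fun s : ℝ => (s, z.2)) z.1 hf.hasFDerivAt h1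

theorem deriv_slice_right {f : ℝ × ℝ → F} {z : ℝ × ℝ} (hf : DifferentiableAt ℝ f z) :
    HasDerivAt (fun r => f (z.1, r)) (fderiv ℝ f z (0, 1)) z.2 := by
  have h1 : HasDerivAt (fun r : ℝ => (z.1, r)) ((0 : ℝ), (1 : ℝ)) z.2 :=
    (hasDerivAt_const _ _).prodMk (hasDerivAt_id _)
  exact HasFDerivAt.comp_hasDerivAt (f := fun r : ℝ => (z.1, r)) z.2 hf.hasFDerivAt h1

theorem hasDerivAt_deriv_slice_right {f : ℝ × ℝ → F} {z : ℝ × ℝ} (hf : ContDiffAt ℝ 2 f z) :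
    HasDerivAt (fun s => deriv (fun r => f (s, r)) z.2)
      (fderiv ℝ (fderiv ℝ f) z (1, 0) (0, 1)) z.1 := by
  have hd : ∀ᶠ w in nhds z, DifferentiableAt ℝ f w := by
    filter_upwards [hf.eventually (by simp)] with w hw using hw.differentiableAt (by simp)
  have hd' : ∀ᶠ s in nhds z.1, DifferentiableAt ℝ f (s, z.2) :=
    (Continuous.prodMk_left z.2).continuousAt.eventually hd
  have h2 : DifferentiableAt ℝ (fderiv ℝ f) z :=
    (hf.fderiv_right (m := 1) (by norm_num)).differentiableAt (by simp)
  have h3 := (deriv_slice_left h2).clm_apply (hasDerivAt_const z.1 ((0 : ℝ), (1 : ℝ)))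
  simp only [map_zero, add_zero] at h3
  refine h3.congr_of_eventuallyEq ?_
  filter_upwards [hd'] with s hs
  exact (deriv_slice_right hs).deriv

theorem hasDerivAt_deriv_slice_left {f : ℝ × ℝ → F} {z : ℝ × ℝ} (hf : ContDiffAt ℝ 2 f z) :
    HasDerivAt (fun r => deriv (fun s => f (s, r)) z.1)
      (fderiv ℝ (fderiv ℝ f) z (0, 1) (1, 0)) z.2 := by
  have hd : ∀ᶠ w in nhds z, DifferentiableAt ℝ f w := by
    filter_upwards [hf.eventually (by simp)] with w hw using hw.differentiableAt (by simp)
  have hd' : ∀ᶠ r in nhds z.2, DifferentiableAt ℝ f (z.1, r) :=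
    (Continuous.prodMk_right z.1).continuousAt.eventually hd
  have h2 : DifferentiableAt ℝ (fderiv ℝ f) z :=
    (hf.fderiv_right (m := 1) (by norm_num)).differentiableAt (by simp)
  have h3 := (deriv_slice_right h2).clm_apply (hasDerivAt_const z.2 ((1 : ℝ), (0 : ℝ)))
  simp only [map_zero, add_zero] at h3
  refine h3.congr_of_eventuallyEq ?_
  filter_upwards [hd'] with s hs
  exact (deriv_slice_left hs).deriv

/-- Mixed partial derivatives of a function of two real variables commute. -/
theorem hasDerivAt_deriv_comm {f : ℝ × ℝ → F} {z : ℝ × ℝ} (hf : ContDiffAt ℝ 2 f z) :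
    HasDerivAt (fun s => deriv (fun r => f (s, r)) z.2)
      (deriv (fun r => deriv (fun s => f (s, r)) z.1) z.2) z.1 := by
  rw [(hasDerivAt_deriv_slice_left hf).deriv,
    (hf.isSymmSndFDerivAt (by simp)).eq (0, 1) (1, 0)]
  exact hasDerivAt_deriv_slice_right hf

theorem _root_.ContDiffAt.deriv_infty {f : ℝ → F} {x : ℝ} (hf : ContDiffAt ℝ ∞ f x) :
    ContDiffAt ℝ ∞ (deriv f) x :=
  (hf.fderiv_right (m := ∞) (by simp)).clm_apply contDiffAt_const

theorem deriv_clm_apply_eventuallyEq {L : ℝ → F →L[ℝ] F'} {h : ℝ → F} {x : ℝ}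
    (hL : ContDiffAt ℝ ∞ L x) (hh : ContDiffAt ℝ ∞ h x) :
    deriv (fun t => L t (h t)) =ᶠ[nhds x] (fun t => deriv L t (h t)) + fun t => L t (deriv h t) := by
  have e1 : ∀ᶠ t in nhds x, DifferentiableAt ℝ L t := by
    filter_upwards [(hL.of_le (m := 1) (by exact_mod_cast le_top)).eventually (by simp)] with w hw
      using hw.differentiableAt (by simp)
  have e2 : ∀ᶠ t in nhds x, DifferentiableAt ℝ h t := by
    filter_upwards [(hh.of_le (m := 1) (by exact_mod_cast le_top)).eventually (by simp)] with w hw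
      using hw.differentiableAt (by simp)
  filter_upwards [e1, e2] with t h1 h2
  exact (h1.hasDerivAt.clm_apply h2.hasDerivAt).deriv

theorem iteratedDeriv_succ_clm_apply {L : ℝ → F →L[ℝ] F'} {h : ℝ → F} {x : ℝ}
    (hL : ContDiffAt ℝ ∞ L x) (hh : ContDiffAt ℝ ∞ h x) (j : ℕ) :
    iteratedDeriv (j + 1) (fun t => L t (h t)) x =
      iteratedDeriv j (fun t => deriv L t (h t)) x +
        iteratedDeriv j (fun t => L t (deriv h t)) x := by
  have hj := natCast_le_infty j
  rw [iteratedDeriv_succ', (deriv_clm_apply_eventuallyEq hL hh).iteratedDeriv_eq,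
    iteratedDeriv_add ((hL.deriv_infty.clm_apply hh).of_le hj)
      ((hL.clm_apply hh.deriv_infty).of_le hj)]

/-- Only the leading term of the Leibniz rule survives when `h` vanishes to order `j - 1`. -/
theorem iteratedDeriv_clm_apply_of_flat_right {L : ℝ → F →L[ℝ] F'} {h : ℝ → F} {x : ℝ} {j : ℕ}
    (hL : ContDiffAt ℝ ∞ L x) (hh : ContDiffAt ℝ ∞ h x)
    (h0 : ∀ i < j, iteratedDeriv i h x = 0) :
    iteratedDeriv j (fun t => L t (h t)) x = L x (iteratedDeriv j h x) := by
  induction j generalizing L h with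
  | zero => simp
  | succ j ih =>
    rw [iteratedDeriv_succ_clm_apply hL hh,
      ih hL.deriv_infty hh fun i hi => h0 i (hi.trans j.lt_succ_self),
      ih hL hh.deriv_infty fun i hi => by
        rw [← iteratedDeriv_succ']; exact h0 _ (Nat.succ_lt_succ hi),
      h0 j j.lt_succ_self, ← iteratedDeriv_succ', map_zero, zero_add]

/-- Every term of the Leibniz rule contains a derivative of `L` of order at most `j`. -/
theorem iteratedDeriv_clm_apply_of_flat_left {L : ℝ → F →L[ℝ] F'} {h : ℝ → F} {x : ℝ} {j : ℕ}
    (hL : ContDiffAt ℝ ∞ L x) (hh : ContDiffAt ℝ ∞ h x)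
    (h0 : ∀ i ≤ j, iteratedDeriv i L x = 0) :
    iteratedDeriv j (fun t => L t (h t)) x = 0 := by
  induction j generalizing L h with
  | zero => simpa using congrArg (fun M => M (h x)) (h0 0 le_rfl)
  | succ j ih =>
    rw [iteratedDeriv_succ_clm_apply hL hh,
      ih hL.deriv_infty hh fun i hi => by
        rw [← iteratedDeriv_succ']; exact h0 _ (Nat.succ_le_succ hi),
      ih hL hh.deriv_infty fun i hi => h0 i (hi.trans j.le_succ), zero_add]

/-- If `p` and `q` agree to order `j`, the `j`-th derivatives of `A(p) p'` and `A(q) q'` differ by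
the value of `A` on the difference of the derivatives of order `j + 1`. -/
theorem iteratedDeriv_coeff_sub {A : F → F →L[ℝ] F'} {p q : ℝ → F} {j : ℕ}
    (hp : ContDiffAt ℝ ∞ p 0) (hq : ContDiffAt ℝ ∞ q 0) (hA : ContDiffAt ℝ ∞ A (p 0))
    (h : ∀ i ≤ j, iteratedDeriv i p 0 = iteratedDeriv i q 0) :
    iteratedDeriv j (fun t => A (p t) (deriv p t)) 0 -
        iteratedDeriv j (fun t => A (q t) (deriv q t)) 0 =
      A (p 0) (iteratedDeriv (j + 1) p 0 - iteratedDeriv (j + 1) q 0) := by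
  have h0 : p 0 = q 0 := by simpa using h 0 (Nat.zero_le _)
  have hAp : ContDiffAt ℝ ∞ (fun t => A (p t)) 0 := hA.comp 0 hp
  have hAq : ContDiffAt ℝ ∞ (fun t => A (q t)) 0 := ContDiffAt.comp 0 (h0 ▸ hA) hq
  have hp' := hp.deriv_infty
  have hq' := hq.deriv_infty
  have hle := natCast_le_infty
  -- Split A(p)p' - A(q)q' as A(p)(p' - q') + (A(p) - A(q))q'. In the first term p' - q' vanishes to
  -- order j - 1, so only the leading Leibniz term survives; in the second, A∘p and A∘q agree to
  -- order j.
  have e1 : iteratedDeriv j (fun t => A (p t) (deriv p t - deriv q t)) 0 =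
      A (p 0) (iteratedDeriv (j + 1) p 0 - iteratedDeriv (j + 1) q 0) := by
    have hs (i : ℕ) : iteratedDeriv i (fun t => deriv p t - deriv q t) 0 =
        iteratedDeriv (i + 1) p 0 - iteratedDeriv (i + 1) q 0 := by
      rw [iteratedDeriv_succ', iteratedDeriv_succ']
      exact iteratedDeriv_sub (hp'.of_le (hle i)) (hq'.of_le (hle i))
    rw [iteratedDeriv_clm_apply_of_flat_right (h := fun t => deriv p t - deriv q t) hAp
      (hp'.sub hq'), hs]
    intro i hi
    rw [hs, h _ hi, sub_self]
  have e2 : iteratedDeriv j (fun t => (A (p t) - A (q t)) (deriv q t)) 0 = 0 := by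
    refine iteratedDeriv_clm_apply_of_flat_left (L := fun t => A (p t) - A (q t)) (hAp.sub hAq) hq'
      fun i hi => ?_
    have := iteratedDeriv_sub (hAp.of_le (hle i)) (hAq.of_le (hle i))
    refine this.trans (sub_eq_zero.2 ?_)
    rw [← iteratedFDeriv_eq_iff]
    exact iteratedDeriv_comp_congr hp hq hA (fun i hi => iteratedFDeriv_eq_iff.2 (h i hi)) hi
  have e3 : (fun t => A (p t) (deriv p t - deriv q t)) + (fun t => (A (p t) - A (q t)) (deriv q t))
      = (fun t => A (p t) (deriv p t)) - fun t => A (q t) (deriv q t) := by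
    funext t
    simp
  rw [← iteratedDeriv_sub ((hAp.clm_apply hp').of_le (hle j)) ((hAq.clm_apply hq').of_le (hle j)),
    ← e3, iteratedDeriv_add ((hAp.clm_apply (hp'.sub hq')).of_le (hle j))
      (((hAp.sub hAq).clm_apply hq').of_le (hle j)), e1, e2, add_zero]

theorem iteratedDeriv_pow_smul (m i : ℕ) (y : F) :
    iteratedDeriv i (fun t : ℝ => t ^ m • y) 0 = if i = m then (m.factorial : ℝ) • y else 0 := by
  have h : iteratedDeriv i (fun t : ℝ => t ^ m • y) 0 = iteratedDeriv i (fun t : ℝ => t ^ m) 0 • y :=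
    iteratedDeriv_smul_const (contDiff_id.pow m).contDiffAt y
  rw [h, iteratedDeriv_fun_pow_zero]
  split_ifs <;> simp

end Calculus

/-! ### Curves in manifolds and their tangent lifts -/

section Curves

variable {E H M : Type*} [NormedAddCommGroup E] [NormedSpace ℝ E] [TopologicalSpace H]
  {I : ModelWithCorners ℝ E H} [TopologicalSpace M] [ChartedSpace H M]

theorem mfderiv_curve_eq_deriv {c : ℝ → M} {t : ℝ} (hc : MDifferentiableAt 𝓘(ℝ, ℝ) I c t) :
    (mfderiv 𝓘(ℝ, ℝ) I c t (1 : ℝ) : E) = deriv (fun s => extChartAt I (c t) (c s)) t := by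
  rw [hc.mfderiv]
  simp only [modelWithCornersSelf_coe, Set.range_id, fderivWithin_univ]
  exact fderiv_apply_one_eq_deriv (𝕜 := ℝ) (F := E)

variable [IsManifold I ∞ M]

theorem extChartAt_tangent_apply (p q : TangentBundle I M) (h : q.1 ∈ (chartAt H p.1).source) :
    extChartAt I.tangent p q =
      (extChartAt I p.1 q.1, (mfderiv I 𝓘(ℝ, E) (extChartAt I p.1) q.1 q.2 : E)) := by
  have : IsManifold I 1 M := IsManifold.of_le (n := ∞) (by simp)
  have h2 := TangentBundle.continuousLinearMapAt_trivializationAt (I := I) h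
  have h3 : ((trivializationAt E (TangentSpace I) p.1).continuousLinearMapAt ℝ q.1 : E →L[ℝ] E)
      q.2 = (mfderiv I 𝓘(ℝ, E) (extChartAt I p.1) q.1 q.2 : E) :=
    congrArg (fun L : E →L[ℝ] E => L q.2) h2
  rw [← h3]
  have h4 : ((trivializationAt E (TangentSpace I) p.1).continuousLinearMapAt ℝ q.1 : E →L[ℝ] E)
      q.2 = (trivializationAt E (TangentSpace I : M → Type _) p.1 q).2 := by
    rw [Bundle.Trivialization.continuousLinearMapAt_apply,
      Bundle.Trivialization.coe_linearMapAt_of_mem _ h]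
  rw [h4, FiberBundle.extChartAt]
  rfl

/-- The velocity of a curve, as an element of the tangent bundle. -/
noncomputable def velocity (I : ModelWithCorners ℝ E H) (c : ℝ → M) (t : ℝ) : TangentBundle I M :=
  tangentMap 𝓘(ℝ, ℝ) I c ⟨t, (1 : ℝ)⟩

/-- Reduces computations in TM and T(TM) to ordinary derivatives; any chart whose domain contains
the current point may be used. -/
theorem extChartAt_velocity (p : TangentBundle I M) {c : ℝ → M} {t : ℝ}
    (hc : MDifferentiableAt 𝓘(ℝ, ℝ) I c t) (h : c t ∈ (chartAt H p.1).source) :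
    extChartAt I.tangent p (velocity I c t) =
      (extChartAt I p.1 (c t), deriv (fun s => extChartAt I p.1 (c s)) t) := by
  have : IsManifold I 1 M := IsManifold.of_le (n := ∞) (by simp)
  rw [extChartAt_tangent_apply p _ h]
  refine congrArg (Prod.mk (extChartAt I p.1 (c t))) ?_
  have h1 := mfderiv_comp_apply (I := 𝓘(ℝ, ℝ)) (I' := I) (I'' := 𝓘(ℝ, E)) (f := c)
    (g := extChartAt I p.1) t (mdifferentiableAt_extChartAt h) hc (1 : ℝ)
  refine h1.symm.trans ?_
  rw [mfderiv_eq_fderiv]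
  exact fderiv_apply_one_eq_deriv (𝕜 := ℝ) (F := E)

theorem contMDiff_velocity {c : ℝ → M} (hc : ContMDiff 𝓘(ℝ, ℝ) I ∞ c) :
    ContMDiff 𝓘(ℝ, ℝ) I.tangent ∞ (velocity I c) := by
  have : IsManifold I 1 M := IsManifold.of_le (n := ∞) (by simp)
  refine (hc.contMDiff_tangentMap (m := ∞) (by simp)).comp ?_
  intro t
  exact contMDiffAt_vectorSpace_iff_contDiffAt.2 contDiffAt_const

theorem velocity_comp_add (c : ℝ → M) {s : ℝ} (hc : MDifferentiableAt 𝓘(ℝ, ℝ) I c s) :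
    velocity I (fun r => c (s + r)) 0 = velocity I c s := by
  have hadd : MDifferentiableAt 𝓘(ℝ, ℝ) 𝓘(ℝ, ℝ) (fun r => s + r) (0 : ℝ) :=
    (differentiableAt_id.const_add s).mdifferentiableAt
  have h1 : tangentMap 𝓘(ℝ, ℝ) 𝓘(ℝ, ℝ) (fun r => s + r) ⟨(0 : ℝ), (1 : ℝ)⟩ = ⟨s, (1 : ℝ)⟩ := by
    refine Bundle.TotalSpace.ext (add_zero s) (heq_of_eq ?_)
    refine (congrArg (fun L : ℝ →L[ℝ] ℝ => L 1) (mfderiv_eq_fderiv (f := fun r => s + r))).trans ?_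
    refine (fderiv_apply_one_eq_deriv (𝕜 := ℝ) (F := ℝ)).trans ?_
    simp
  have h2 := tangentMap_comp_at (I := 𝓘(ℝ, ℝ)) (I' := 𝓘(ℝ, ℝ)) (I'' := I) (f := fun r => s + r)
    (g := c) ⟨(0 : ℝ), (1 : ℝ)⟩ (by simpa using hc) hadd
  exact h2.trans (congrArg _ h1)

end Curves

/-! ### Logarithmic derivatives and velocity lifts of curves in a Lie group. -/

section LieGroupCurves

variable {E H G : Type u} [NormedAddCommGroup E] [NormedSpace ℝ E] [TopologicalSpace H]
  {I : ModelWithCorners ℝ E H} [TopologicalSpace G] [ChartedSpace H G] [Group G] [LieGroup I ∞ G]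

theorem velocity_mul {c b : ℝ → G} (hc : MDifferentiable 𝓘(ℝ, ℝ) I c)
    (hb : MDifferentiable 𝓘(ℝ, ℝ) I b) (t : ℝ) :
    velocity I (fun s => c s * b s) t = velocity I c t * velocity I b t :=
  tangentMap_mul hc hb _

theorem velocity_inv {c : ℝ → G} (hc : MDifferentiable 𝓘(ℝ, ℝ) I c) (t : ℝ) :
    velocity I (fun s => (c s)⁻¹) t = (velocity I c t)⁻¹ :=
  tangentMap_inv hc _

/-- The translated curve c(s)c(t)⁻¹ passes through 1 at s = t, so the one chart at 1 serves for all
t. This removes the moving base point and makes differentiation in t possible. -/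
theorem rightLogDeriv_eq (c : SmoothCurve I G) (t : ℝ) :
    rightLogDeriv I c t = deriv (fun s => extChartAt I (1 : G) (c s * (c t)⁻¹)) t := by
  have hd : MDifferentiable I I (fun x : G => x * (c t)⁻¹) :=
    (contMDiff_mul_right (n := ∞)).mdifferentiable (by simp)
  have hc : MDifferentiable 𝓘(ℝ, ℝ) I c := c.contMDiff.mdifferentiable (by simp)
  have h := mfderiv_comp_apply (I := 𝓘(ℝ, ℝ)) (I' := I) (I'' := I) (f := c)
    (g := fun x : G => x * (c t)⁻¹) t (hd _) (hc _) (1 : ℝ)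
  have h2 := mfderiv_curve_eq_deriv (I := I) (c := (fun x : G => x * (c t)⁻¹) ∘ c) (t := t)
    ((hd _).comp t (hc t))
  refine (h.symm.trans h2).trans ?_
  simp only [Function.comp, mul_inv_cancel]
  rfl

variable (I) in
/-- The lift of smooth curves to the tangent group, as a homomorphism. -/
noncomputable def liftCurve : SmoothCurve I G →* SmoothCurve I.tangent (TangentBundle I G) where
  toFun c := ⟨velocity I c, contMDiff_velocity c.contMDiff⟩
  map_one' := by
    exact ContMDiffMap.ext fun t => tangentMap_one _
  map_mul' c b := by
    exact ContMDiffMap.ext fun t => velocity_mul (c.contMDiff.mdifferentiable (by simp))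
      (b.contMDiff.mdifferentiable (by simp)) t

theorem contMDiff_curve_prod (c : SmoothCurve I G) {f g : ℝ × ℝ → ℝ} (hf : ContDiff ℝ ∞ f)
    (hg : ContDiff ℝ ∞ g) :
    ContMDiff 𝓘(ℝ, ℝ × ℝ) I ∞ (fun z : ℝ × ℝ => c (f z) * (c (g z))⁻¹) :=
  (c.contMDiff.comp hf.contMDiff).mul (c.contMDiff.comp hg.contMDiff).inv

theorem contDiffAt_extChartAt_comp {N : Type*} [NormedAddCommGroup N] [NormedSpace ℝ N] {x : G}
    {F : N → G} {z : N} (hF : ContMDiffAt 𝓘(ℝ, N) I ∞ F z) (hx : F z ∈ (chartAt H x).source) :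
    ContDiffAt ℝ ∞ (fun w => extChartAt I x (F w)) z := by
  rw [← contMDiffAt_iff_contDiffAt]
  exact (contMDiffAt_extChartAt' hx).comp z hF

/-- δc(t) is the first partial derivative at (t, t) of the chart expression of c(s)c(r)⁻¹, which is
smooth near the diagonal. -/
theorem contDiff_rightLogDeriv (c : SmoothCurve I G) : ContDiff ℝ ∞ (rightLogDeriv I c) := by
  rw [contDiff_iff_contDiffAt]
  intro t
  have hF (t : ℝ) : ContDiffAt ℝ ∞
      (fun z : ℝ × ℝ => extChartAt I (1 : G) (c z.1 * (c z.2)⁻¹)) (t, t) :=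
    contDiffAt_extChartAt_comp (contMDiff_curve_prod c contDiff_fst contDiff_snd).contMDiffAt
      (by simp)
  have e : rightLogDeriv I c = fun t =>
      fderiv ℝ (fun z : ℝ × ℝ => extChartAt I (1 : G) (c z.1 * (c z.2)⁻¹)) (t, t) (1, 0) := by
    funext t
    rw [rightLogDeriv_eq]
    exact (deriv_slice_left ((hF t).differentiableAt (by simp))).deriv
  rw [e]
  have h1 := (hF t).fderiv_right (m := ∞) (by simp)
  have h2 : ContDiffAt ℝ ∞ (fun t : ℝ => (t, t)) t := contDiffAt_id.prodMk contDiffAt_id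
  exact (ContDiffAt.comp (f := fun t : ℝ => (t, t)) t h1 h2).clm_apply contDiffAt_const

/-- The right logarithmic derivative of the tangent lift of a curve consists of the logarithmic
derivative of the curve and its derivative. -/
theorem rightLogDeriv_liftCurve (c : SmoothCurve I G) (t : ℝ) :
    rightLogDeriv I.tangent (liftCurve I c) t =
      (rightLogDeriv I c t, deriv (rightLogDeriv I c) t) := by
  have hadd (s : ℝ) : ContMDiff 𝓘(ℝ, ℝ) I ∞ (fun r => c (s + r)) :=
    c.contMDiff.comp (contDiff_const.add contDiff_id).contMDiff
  have hcs (s : ℝ) : MDifferentiable 𝓘(ℝ, ℝ) I (fun r => c (s + r)) :=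
    (hadd s).mdifferentiable (by simp)
  have hc : MDifferentiable 𝓘(ℝ, ℝ) I c := c.contMDiff.mdifferentiable (by simp)
  have hinv : MDifferentiable 𝓘(ℝ, ℝ) I (fun r => (c (t + r))⁻¹) :=
    (hadd t).inv.mdifferentiable (by simp)
  have hmul (s : ℝ) : MDifferentiable 𝓘(ℝ, ℝ) I (fun r => c (s + r) * (c (t + r))⁻¹) :=
    ((hadd s).mul (hadd t).inv).mdifferentiable (by simp)
  have hF := contMDiff_curve_prod c (f := fun z => z.1 + z.2) (g := fun z => t + z.2)
    (contDiff_fst.add contDiff_snd) (contDiff_const.add contDiff_snd)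
  -- Shifting both factors by a common r turns the quotient of two velocities into the velocity of
  -- one curve in r.
  have hv (s : ℝ) : liftCurve I c s * (liftCurve I c t)⁻¹ =
      velocity I (fun r => c (s + r) * (c (t + r))⁻¹) 0 := by
    rw [velocity_mul (hcs s) hinv, velocity_inv (hcs t),
      velocity_comp_add _ (hc _), velocity_comp_add _ (hc _)]
    rfl
  have hchart : ContDiffAt ℝ ∞ (fun z : ℝ × ℝ =>
      extChartAt I (1 : G) (c (z.1 + z.2) * (c (t + z.2))⁻¹)) (t, 0) :=
    contDiffAt_extChartAt_comp hF.contMDiffAt (by simp)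
  have hnear : ∀ᶠ s in nhds t, c s * (c t)⁻¹ ∈ (chartAt H (1 : G)).source := by
    have : ContinuousAt (fun s => c s * (c t)⁻¹) t :=
      ((c.contMDiff.mul contMDiff_const).continuous (I' := I)).continuousAt
    exact this.eventually_mem ((chartAt H (1 : G)).open_source.mem_nhds (by simp))
  rw [rightLogDeriv_eq]
  have e1 : (fun s => extChartAt I.tangent (1 : TangentBundle I G)
      (liftCurve I c s * (liftCurve I c t)⁻¹)) =ᶠ[nhds t] fun s =>
        (extChartAt I (1 : G) (c s * (c t)⁻¹),
          deriv (fun r => extChartAt I (1 : G) (c (s + r) * (c (t + r))⁻¹)) 0) := by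
    filter_upwards [hnear] with s hs
    rw [hv]
    refine (extChartAt_velocity (1 : TangentBundle I G) (hmul s 0)
      (by simpa [tangentOne_def] using hs)).trans ?_
    simp [tangentOne_def]
  rw [e1.deriv_eq]
  have d1 : HasDerivAt (fun s => extChartAt I (1 : G) (c s * (c t)⁻¹)) (rightLogDeriv I c t) t := by
    rw [rightLogDeriv_eq]
    have := (deriv_slice_left (hchart.differentiableAt (by simp))).differentiableAt.hasDerivAt
    simpa using this
  -- The fibre coordinate is ∂_s∂_r; exchanged to ∂_r∂_s, its inner derivative is δc(t + r).
  have d2 := hasDerivAt_deriv_comm (hchart.of_le two_le_infty)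
  have e3 : (fun r => deriv (fun s => extChartAt I (1 : G) (c (s + r) * (c (t + r))⁻¹)) t) =
      fun r => rightLogDeriv I c (t + r) := by
    funext r
    rw [rightLogDeriv_eq]
    exact deriv_comp_add_const (f := fun s => extChartAt I (1 : G) (c s * (c (t + r))⁻¹)) r t
  simp only [e3] at d2
  rw [deriv_comp_const_add, add_zero] at d2
  exact (d1.prodMk d2).deriv

end LieGroupCurves

/-! ### Lifting curves to the iterated tangent groups -/

section TowerCurves

variable {E H G : Type u} [NormedAddCommGroup E] [NormedSpace ℝ E] [TopologicalSpace H]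
  (I : ModelWithCorners ℝ E H) [TopologicalSpace G] [ChartedSpace H G] [Group G] [LieGroup I ∞ G]

theorem Idx.card_up {k : ℕ} (α : Idx k) : α.up.card = α.card := Finset.card_map _

theorem Idx.card_add {k : ℕ} (α : Idx k) : α.add.card = α.card + 1 := by
  rw [Idx.add, Finset.card_insert_of_notMem α.last_notMem_up, Idx.card_up]

theorem Idx.card_down_of_notMem {k : ℕ} {α : Idx (k + 1)} (h : Fin.last k ∉ α) :
    α.down.card = α.card := by
  rw [← Idx.card_up, Idx.up_down h]

theorem Idx.card_down_of_mem {k : ℕ} {α : Idx (k + 1)} (h : Fin.last k ∈ α) :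
    α.down.card + 1 = α.card := by
  rw [← Idx.card_add, Idx.add_down h]

/-- The `k`-fold tangent lift `t ↦ c(t + ε₁ + ⋯ + ε_k)` of smooth curves. -/
noncomputable def liftTower :
    (k : ℕ) → SmoothCurve I G →* SmoothCurve (tower I G k).I (tower I G k).G
  | 0 => MonoidHom.id _
  | k + 1 => (liftCurve (tower I G k).I).comp (liftTower k)

-- `lieAlgebraSplit` is only a linear equivalence; continuity of its components is what allows a
-- derivative to be taken through them.
variable (G) in
theorem exists_clm_lieAlgebraSplit (k : ℕ) (α : Idx k) :
    ∃ L : (tower I G k).E →L[ℝ] E, ∀ x : GroupLieAlgebra (tower I G k).I (tower I G k).G,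
      lieAlgebraSplit I G k x α = L x := by
  induction k with
  | zero => exact ⟨ContinuousLinearMap.id ℝ E, fun _ => rfl⟩
  | succ k ih =>
    obtain ⟨L, hL⟩ := ih α.down
    by_cases h : Fin.last k ∈ α
    · refine ⟨L.comp (ContinuousLinearMap.snd ℝ (tower I G k).E (tower I G k).E), fun x => ?_⟩
      refine Eq.trans ?_ (hL _)
      exact if_pos h
    · refine ⟨L.comp (ContinuousLinearMap.fst ℝ (tower I G k).E (tower I G k).E), fun x => ?_⟩
      refine Eq.trans ?_ (hL _)
      exact if_neg h

theorem rightLogDeriv_liftTower_succ (k : ℕ) (c : SmoothCurve I G) (t : ℝ) :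
    rightLogDeriv (tower I G (k + 1)).I (liftTower I (k + 1) c) t =
      ((rightLogDeriv (tower I G k).I (liftTower I k c) t,
        deriv (F := (tower I G k).E) (rightLogDeriv (tower I G k).I (liftTower I k c)) t) :
          (tower I G k).E × (tower I G k).E) :=
  rightLogDeriv_liftCurve (liftTower I k c) t

/-- Each lift replaces δ by (δ, δ'), so every unit in `α` costs one derivative. Here `α = ∅` is
allowed and there is no shift by one. -/
theorem lieAlgebraSplit_rightLogDeriv (k : ℕ) (c : SmoothCurve I G) (α : Idx k) (t : ℝ) :
    lieAlgebraSplit I G k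
        (rightLogDeriv (tower I G k).I (liftTower I k c) t : (tower I G k).E) α =
      iteratedDeriv (F := E) α.card (rightLogDeriv I c) t := by
  induction k generalizing t with
  | zero =>
    have : α = ∅ := Subsingleton.elim _ _
    subst this
    simp only [Finset.card_empty, iteratedDeriv_zero]
    rfl
  | succ k ih =>
    rw [rightLogDeriv_liftTower_succ]
    by_cases h : Fin.last k ∈ α
    · refine (if_pos h).trans ?_
      obtain ⟨L, hL⟩ := exists_clm_lieAlgebraSplit G I k α.down
      have hd : DifferentiableAt ℝ (rightLogDeriv (tower I G k).I (liftTower I k c)) t :=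
        (contDiff_rightLogDeriv (liftTower I k c)).differentiable (by simp) t
      refine (hL _).trans ?_
      have h1 := (HasFDerivAt.comp_hasDerivAt (l := L)
        (f := rightLogDeriv (tower I G k).I (liftTower I k c)) t L.hasFDerivAt hd.hasDerivAt).deriv
      refine h1.symm.trans ?_
      rw [← Idx.card_down_of_mem h, iteratedDeriv_succ]
      congr 1
      funext s
      exact (hL _).symm.trans (ih α.down s)
    · refine (if_neg h).trans ?_
      rw [← Idx.card_down_of_notMem h]
      exact ih α.down t

theorem rightTriv_succ (k : ℕ) (u : TangentBundle (tower I G k).I (tower I G k).G) :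
    rightTriv I G (k + 1) u = ((rightTriv I G k u.1).1, glueStar k ((rightTriv I G k u.1).2,
      lieAlgebraSplit I G k (rightTranslate (tower I G k).I u.2 u.1⁻¹))) := rfl

theorem rightTriv_liftTower (k : ℕ) (c : SmoothCurve I G) (t : ℝ) :
    rightTriv I G k (liftTower I k c t) =
      (c t, fun α => iteratedDeriv (α.1.card - 1) (rightLogDeriv I c) t) := by
  induction k with
  | zero =>
    refine Prod.ext rfl (funext fun α => ?_)
    obtain ⟨i, -⟩ := α.2
    exact i.elim0
  | succ k ih =>
    refine (rightTriv_succ I k _).trans ?_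
    have h1 : rightTriv I G k (liftTower I (k + 1) c t : TangentBundle _ _).1 = _ := ih
    rw [h1]
    refine Prod.ext rfl (funext fun α => ?_)
    by_cases h : Fin.last k ∈ α.1
    · refine (dif_pos h).trans ?_
      refine (lieAlgebraSplit_rightLogDeriv I k c α.1.down t).trans ?_
      -- The shift by one arises here: the largest unit of `α` is the direction of the tangent
      -- vector itself, and only the remaining units differentiate δc.
      have h2 : α.1.down.card = α.1.card - 1 := by
        rw [← Idx.card_down_of_mem h, Nat.add_sub_cancel]
      exact congrArg (fun n => iteratedDeriv n (rightLogDeriv I c) t) h2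
    · refine (dif_neg h).trans ?_
      simp only [Idx.card_down_of_notMem h]
      rfl

/-- The homomorphism `c ↦ c(ε₁ + ⋯ + ε_k)` from smooth curves to the higher tangent group. -/
noncomputable def jetTower (k : ℕ) : SmoothCurve I G →* HigherTangent I G k where
  toFun c := liftTower I k c 0
  map_one' := by rw [map_one]; rfl
  map_mul' c b := by rw [map_mul]; rfl

theorem rightTriv_jetTower (k : ℕ) (c : SmoothCurve I G) :
    rightTriv I G k (jetTower I k c) =
      (c 0, fun α => iteratedDeriv (α.1.card - 1) (rightLogDeriv I c) 0) :=
  rightTriv_liftTower I k c 0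

theorem rightTriv_smul {k : ℕ} (σ : Equiv.Perm (Fin k)) (u : HigherTangent I G k) :
    rightTriv I G k (σ • u) = permUnits σ (rightTriv I G k u) :=
  (rightTriv I G k).apply_symm_apply _

theorem exists_permIdx_eq {k : ℕ} {α β : IdxStar k} (h : α.1.card = β.1.card) :
    ∃ σ : Equiv.Perm (Fin k), permIdx σ α = β := by
  let e : {i // i ∈ α.1} ≃ {i // i ∈ β.1} := Finset.equivOfCardEq h
  refine ⟨e.extendSubtype, Subtype.ext ?_⟩
  refine Finset.eq_of_subset_of_card_le (fun i hi => ?_) ?_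
  · obtain ⟨j, hj, rfl⟩ := Finset.mem_map.1 hi
    exact e.extendSubtype_mem j hj
  · simp [permIdx, h]

/-- S_k acts transitively on the subsets of each fixed cardinality. -/
theorem mem_fixedPoints_iff {k : ℕ} (u : HigherTangent I G k) :
    u ∈ MulAction.fixedPoints (Equiv.Perm (Fin k)) (HigherTangent I G k) ↔
      ∀ α β : IdxStar k, α.1.card = β.1.card → (rightTriv I G k u).2 α = (rightTriv I G k u).2 β := by
  constructor
  · intro h α β hαβ
    obtain ⟨σ, rfl⟩ := exists_permIdx_eq hαβ
    have h1 := congrArg (fun v => (rightTriv I G k v).2 (permIdx σ α)) (h σ)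
    simp only [rightTriv_smul, permUnits, ← permIdx_mul, inv_mul_cancel, permIdx_one] at h1
    exact h1
  · intro h σ
    apply (rightTriv I G k).injective
    rw [rightTriv_smul]
    refine Prod.ext rfl (funext fun α => h _ _ ?_)
    exact Finset.card_map _

theorem jetTower_mem_fixedPoints (k : ℕ) (c : SmoothCurve I G) :
    jetTower I k c ∈ MulAction.fixedPoints (Equiv.Perm (Fin k)) (HigherTangent I G k) := by
  rw [mem_fixedPoints_iff, rightTriv_jetTower]
  intro α β h
  simp only [h]
  rfl

theorem exists_idxStar_card {k j : ℕ} (hj : j < k) : ∃ α : IdxStar k, α.1.card = j + 1 := by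
  obtain ⟨s, -, hs⟩ := Finset.exists_subset_card_eq (s := (Finset.univ : Finset (Fin k)))
    (n := j + 1) (by simpa using hj)
  exact ⟨⟨s, Finset.card_pos.1 (by omega)⟩, hs⟩

theorem jetTower_eq_iff (k : ℕ) (c b : SmoothCurve I G) :
    jetTower I k c = jetTower I k b ↔ c 0 = b 0 ∧ ∀ j < k,
      iteratedDeriv j (rightLogDeriv I c) 0 = iteratedDeriv j (rightLogDeriv I b) 0 := by
  rw [← (rightTriv I G k).injective.eq_iff, rightTriv_jetTower, rightTriv_jetTower]
  refine Prod.ext_iff.trans ?_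
  refine and_congr_right fun _ => ⟨fun h j hj => ?_, fun h => funext fun α => h _ ?_⟩
  · obtain ⟨α, hα⟩ := exists_idxStar_card hj
    simpa [hα] using congrFun h α
  · have h1 := α.1.card_le_univ
    have h2 := Finset.card_pos.2 α.2
    simp only [Fintype.card_fin] at h1
    omega

end TowerCurves

/-! ### Jets and logarithmic derivatives -/

section ChartCoefficient

variable {E H G : Type u} [NormedAddCommGroup E] [NormedSpace ℝ E] [TopologicalSpace H]
  (I : ModelWithCorners ℝ E H) [TopologicalSpace G] [ChartedSpace H G] [Group G] [LieGroup I ∞ G]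
  [I.Boundaryless]

theorem contMDiffAt_extChartAt_symm_self (x : G) :
    ContMDiffAt 𝓘(ℝ, E) I ∞ (extChartAt I x).symm (extChartAt I x x) :=
  (contMDiffOn_extChartAt_symm x).contMDiffAt (extChartAt_target_mem_nhds x)

/-- Right translation by `h`, read in the charts around `x` and `x * h`. -/
noncomputable def rightTranslateChart (x h : G) (q : E) : E :=
  extChartAt I (x * h) ((extChartAt I x).symm q * h)

theorem contDiffAt_rightTranslateChart (x h : G) :
    ContDiffAt ℝ ∞ (rightTranslateChart I x h) (extChartAt I x x) := by
  refine contDiffAt_extChartAt_comp (F := fun q => (extChartAt I x).symm q * h)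
    ((contMDiffAt_extChartAt_symm_self I x).mul contMDiffAt_const) ?_
  simp

theorem rightTranslateChart_self (x h : G) :
    rightTranslateChart I x h (extChartAt I x x) = extChartAt I (x * h) (x * h) := by
  simp [rightTranslateChart]

theorem rightTranslateChart_leftInverse (x h : G) :
    (fun q => rightTranslateChart I (x * h) h⁻¹ (rightTranslateChart I x h q))
      =ᶠ[nhds (extChartAt I x x)] id := by
  have hc : ContinuousAt (fun q => (extChartAt I x).symm q * h) (extChartAt I x x) :=
    ((contMDiffAt_extChartAt_symm_self I x).mul contMDiffAt_const).continuousAt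
  have h1 := hc.eventually_mem (s := (extChartAt I (x * h)).source)
    (by simpa using extChartAt_source_mem_nhds (I := I) (x * h))
  filter_upwards [h1, extChartAt_target_mem_nhds (I := I) x] with q hq hq'
  rw [rightTranslateChart, rightTranslateChart, (extChartAt I (x * h)).left_inv hq,
    mul_inv_cancel_right, mul_inv_cancel_right, (extChartAt I x).right_inv hq', id]

theorem fderiv_rightTranslateChart_comp (x h : G) (v : E) :
    fderiv ℝ (rightTranslateChart I (x * h) h⁻¹) (extChartAt I (x * h) (x * h))
      (fderiv ℝ (rightTranslateChart I x h) (extChartAt I x x) v) = v := by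
  have h1 := (contDiffAt_rightTranslateChart I x h).differentiableAt (by simp)
  have h2 := (contDiffAt_rightTranslateChart I (x * h) h⁻¹).differentiableAt (by simp)
  rw [← rightTranslateChart_self] at h2
  have h3 := (h2.hasFDerivAt.comp _ h1.hasFDerivAt).congr_of_eventuallyEq
    (rightTranslateChart_leftInverse I x h).symm
  have h4 := congrArg (fun L : E →L[ℝ] E => L v) (h3.unique (hasFDerivAt_id _))
  rw [← rightTranslateChart_self]
  exact h4

/-- Translation by `h⁻¹` inverts translation by `h`. The same left-inverse identity gives
injectivity for `h` and, with `h⁻¹` in place of `h`, surjectivity. -/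
theorem bijective_fderiv_rightTranslateChart (x h : G) :
    Function.Bijective (fderiv ℝ (rightTranslateChart I x h) (extChartAt I x x)) := by
  refine ⟨(Function.LeftInverse.injective (fderiv_rightTranslateChart_comp I x h)), fun v => ?_⟩
  have h1 := fderiv_rightTranslateChart_comp I (x * h) h⁻¹ v
  have h2 : x * h * h⁻¹ = x := mul_inv_cancel_right x h
  rw [h2, inv_inv] at h1
  exact ⟨_, h1⟩

/-- In the chart around `g`, the right logarithmic derivative of a curve `p` is `A(p) p'` for
the coefficient `A = logCoeff g`. -/
noncomputable def logCoeff (g : G) (p : E) : E →L[ℝ] E :=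
  fderiv ℝ (fun q => extChartAt I (1 : G) ((extChartAt I g).symm q * ((extChartAt I g).symm p)⁻¹)) p

theorem contDiffAt_mul_inv_chart (g : G) :
    ContDiffAt ℝ ∞ (fun z : E × E =>
      extChartAt I (1 : G) ((extChartAt I g).symm z.2 * ((extChartAt I g).symm z.1)⁻¹))
      (extChartAt I g g, extChartAt I g g) := by
  have s := contMDiffAt_extChartAt_symm_self I g
  have s1 : ContMDiffAt 𝓘(ℝ, E × E) I ∞ (fun z : E × E => (extChartAt I g).symm z.1)
      (extChartAt I g g, extChartAt I g g) :=
    s.comp (extChartAt I g g, extChartAt I g g) contDiff_fst.contDiffAt.contMDiffAt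
  have s2 : ContMDiffAt 𝓘(ℝ, E × E) I ∞ (fun z : E × E => (extChartAt I g).symm z.2)
      (extChartAt I g g, extChartAt I g g) :=
    s.comp (extChartAt I g g, extChartAt I g g) contDiff_snd.contDiffAt.contMDiffAt
  exact contDiffAt_extChartAt_comp (s2.mul s1.inv) (by simp)

theorem contDiffAt_logCoeff (g : G) : ContDiffAt ℝ ∞ (logCoeff I g) (extChartAt I g g) :=
  ContDiffAt.fderiv (f := fun p q =>
    extChartAt I (1 : G) ((extChartAt I g).symm q * ((extChartAt I g).symm p)⁻¹)) (g := id)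
    (contDiffAt_mul_inv_chart I g) contDiffAt_id (by simp)

theorem bijective_logCoeff (g : G) : Function.Bijective (logCoeff I g (extChartAt I g g)) := by
  have h := bijective_fderiv_rightTranslateChart I g g⁻¹
  have e : rightTranslateChart I g g⁻¹ = fun q => extChartAt I (1 : G)
      ((extChartAt I g).symm q * ((extChartAt I g).symm (extChartAt I g g))⁻¹) := by
    funext q
    simp [rightTranslateChart]
  rwa [e] at h

theorem rightLogDeriv_eventuallyEq (c : SmoothCurve I G) :
    rightLogDeriv I c =ᶠ[nhds 0] fun t => logCoeff I (c 0) (extChartAt I (c 0) (c t))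
      (deriv (fun s => extChartAt I (c 0) (c s)) t) := by
  have hcont : Continuous c := c.contMDiff.continuous
  have hp := contDiffAt_chart I c
  have e1 : ∀ᶠ t in nhds (0 : ℝ), c t ∈ (extChartAt I (c 0)).source :=
    hcont.continuousAt.eventually_mem (extChartAt_source_mem_nhds _)
  have e2 : ∀ᶠ t in nhds (0 : ℝ), DifferentiableAt ℝ (fun s => extChartAt I (c 0) (c s)) t := by
    filter_upwards [(hp.of_le two_le_infty).eventually (by simp)] with t ht
      using ht.differentiableAt (by simp)
  have e3 : ∀ᶠ t in nhds (0 : ℝ), DifferentiableAt ℝ (fun z : E × E =>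
      extChartAt I (1 : G) ((extChartAt I (c 0)).symm z.2 * ((extChartAt I (c 0)).symm z.1)⁻¹))
      (extChartAt I (c 0) (c t), extChartAt I (c 0) (c t)) := by
    have := ((contDiffAt_mul_inv_chart I (c 0)).of_le two_le_infty).eventually (by simp)
    filter_upwards [(hp.continuousAt.prodMk hp.continuousAt).eventually this] with t ht
      using ht.differentiableAt (by simp)
  -- Differentiating at `t` needs the curve to stay in the chart for all parameters near `t`, hence
  -- `eventually_nhds`.
  filter_upwards [e1.eventually_nhds, e2, e3] with t h1 h2 h3
  rw [rightLogDeriv_eq]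
  have h4 : DifferentiableAt ℝ (fun q => extChartAt I (1 : G)
      ((extChartAt I (c 0)).symm q * ((extChartAt I (c 0)).symm (extChartAt I (c 0) (c t)))⁻¹))
      (extChartAt I (c 0) (c t)) :=
    DifferentiableAt.comp (f := fun q => (extChartAt I (c 0) (c t), q)) _ h3
      ((differentiableAt_const _).prodMk differentiableAt_id)
  have h5 := HasFDerivAt.comp_hasDerivAt (f := fun s => extChartAt I (c 0) (c s)) t
    h4.hasFDerivAt h2.hasDerivAt
  refine (h5.congr_of_eventuallyEq ?_).deriv
  filter_upwards [h1] with s hs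
  simp only [Function.comp, (extChartAt I (c 0)).left_inv hs,
    (extChartAt I (c 0)).left_inv h1.self_of_nhds]

/-! ### Curves with prescribed logarithmic derivatives at 0. -/

theorem exists_curve (g : G) {p : ℝ → E} (hp : ContDiff ℝ ∞ p) (h0 : p 0 = extChartAt I g g) :
    ∃ c : SmoothCurve I G, c 0 = g ∧ (fun t => extChartAt I g (c t)) =ᶠ[nhds 0] p := by
  have hopen : IsOpen (extChartAt I g).target := isOpen_extChartAt_target g
  have hU : p ⁻¹' (extChartAt I g).target ∈ nhds 0 :=
    hp.continuous.continuousAt.preimage_mem_nhds (by rw [h0]; exact extChartAt_target_mem_nhds g)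
  obtain ⟨δ, hδ, hball⟩ := Metric.mem_nhds_iff.1 hU
  -- The path `p` may leave the chart, so it is reparametrized by t ↦ f(t)t, which is t near 0 and
  -- always has absolute value below δ.
  let f : ContDiffBump (0 : ℝ) := ⟨δ / 2, δ, by positivity, by linarith⟩
  have hρ : ContDiff ℝ ∞ (fun t => f t * t) := f.contDiff.mul contDiff_id
  have hmem (t : ℝ) : p (f t * t) ∈ (extChartAt I g).target := by
    refine hball ?_
    rw [mem_ball_zero_iff, Real.norm_eq_abs, abs_mul, abs_of_nonneg f.nonneg]
    by_cases ht : |t| < δ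
    · exact (mul_le_of_le_one_left (abs_nonneg t) f.le_one).trans_lt ht
    · rw [f.zero_of_le_dist (by simpa using not_lt.1 ht), zero_mul]
      exact hδ
  refine ⟨⟨fun t => (extChartAt I g).symm (p (f t * t)), ?_⟩, ?_, ?_⟩
  · intro t
    exact ((contMDiffOn_extChartAt_symm g).contMDiffAt (hopen.mem_nhds (hmem t))).comp t
      (hp.comp hρ).contMDiff.contMDiffAt
  · change (extChartAt I g).symm (p (f 0 * 0)) = g
    simp [h0]
  · filter_upwards [f.eventuallyEq_one] with t ht
    change extChartAt I g ((extChartAt I g).symm (p (f t * t))) = p t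
    rw [(extChartAt I g).right_inv (hmem t), ht, Pi.one_apply, one_mul]

/-- The derivatives are corrected one order at a time: adding a multiple of t^(k+1) to `p` alters
A(p)p' at 0 only from order k on. -/
theorem exists_chart_curve (g : G) (x : ℕ → E) (k : ℕ) :
    ∃ p : ℝ → E, ContDiff ℝ ∞ p ∧ p 0 = extChartAt I g g ∧
      ∀ j < k, iteratedDeriv j (fun t => logCoeff I g (p t) (deriv p t)) 0 = x j := by
  induction k with
  | zero => exact ⟨fun _ => extChartAt I g g, contDiff_const, rfl, by simp⟩
  | succ k ih =>
    obtain ⟨p, hp, h0, hj⟩ := ih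
    obtain ⟨y, hy⟩ := (bijective_logCoeff I g).2
      (x k - iteratedDeriv k (fun t => logCoeff I g (p t) (deriv p t)) 0)
    have hf : ((k + 1).factorial : ℝ) ≠ 0 := by exact_mod_cast (k + 1).factorial_ne_zero
    -- Normalized so that the derivative of order k + 1 at 0 is `y`, whose image under A(p(0)) is
    -- the missing amount at order k.
    let r : ℝ → E := fun t => t ^ (k + 1) • ((((k + 1).factorial : ℝ)⁻¹) • y)
    have hr : ContDiff ℝ ∞ r := (contDiff_id.pow _).smul contDiff_const
    have hq : ContDiff ℝ ∞ (p + r) := hp.add hr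
    have hri (i : ℕ) : iteratedDeriv i (p + r) 0 =
        iteratedDeriv i p 0 + if i = k + 1 then y else 0 := by
      rw [iteratedDeriv_add (hp.contDiffAt.of_le (natCast_le_infty i))
        (hr.contDiffAt.of_le (natCast_le_infty i)), iteratedDeriv_pow_smul, smul_inv_smul₀ hf]
    have hq0 : (p + r) 0 = extChartAt I g g := by simp [r, h0]
    have hsub (j : ℕ) (hjk : j ≤ k) := iteratedDeriv_coeff_sub (A := logCoeff I g) (j := j)
      hq.contDiffAt hp.contDiffAt (hq0 ▸ contDiffAt_logCoeff I g)
      (fun i hi => by rw [hri, if_neg (by omega), add_zero])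
    refine ⟨p + r, hq, hq0, fun j hjk => ?_⟩
    have h1 := hsub j (by omega)
    rw [hri, add_sub_cancel_left, hq0, sub_eq_iff_eq_add] at h1
    rw [h1]
    split_ifs with h2
    · obtain rfl : j = k := by omega
      rw [hy, sub_add_cancel]
    · rw [map_zero, zero_add, hj j (by omega)]

theorem exists_curve_rightLogDeriv (g : G) (x : ℕ → E) (k : ℕ) :
    ∃ c : SmoothCurve I G, c 0 = g ∧ ∀ j < k, iteratedDeriv j (rightLogDeriv I c) 0 = x j := by
  obtain ⟨p, hp, h0, hj⟩ := exists_chart_curve I g x k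
  obtain ⟨c, rfl, hc⟩ := exists_curve I g hp h0
  refine ⟨c, rfl, fun j hjk => ?_⟩
  rw [← hj j hjk]
  refine Filter.EventuallyEq.iteratedDeriv_eq j ((rightLogDeriv_eventuallyEq I c).trans ?_)
  filter_upwards [hc.eventuallyEq_nhds] with t ht
  rw [ht.deriv_eq, ht.eq_of_nhds]

/-- Order j of δ corresponds to order j + 1 of the chart expression, the value at 0 being order
zero. The converse climbs by induction, using injectivity of the coefficient A at the base point. -/
theorem sameJet_iff (k : ℕ) (c b : SmoothCurve I G) :
    SameJet I k c b ↔ c 0 = b 0 ∧ ∀ j < k,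
      iteratedDeriv j (rightLogDeriv I c) 0 = iteratedDeriv j (rightLogDeriv I b) 0 := by
  refine and_congr_right fun h0 => ?_
  have hp := contDiffAt_chart I c
  have hq := contDiffAt_chart I b
  have ec := fun j => (rightLogDeriv_eventuallyEq I c).iteratedDeriv_eq j
  have eb := fun j => (rightLogDeriv_eventuallyEq I b).iteratedDeriv_eq j
  rw [← h0] at hq eb
  have hsub (j : ℕ) (h : ∀ i ≤ j, iteratedDeriv i (fun t => extChartAt I (c 0) (c t)) 0 =
      iteratedDeriv i (fun t => extChartAt I (c 0) (b t)) 0) :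
      iteratedDeriv j (rightLogDeriv I c) 0 - iteratedDeriv j (rightLogDeriv I b) 0 =
        logCoeff I (c 0) (extChartAt I (c 0) (c 0))
          (iteratedDeriv (j + 1) (fun t => extChartAt I (c 0) (c t)) 0 -
            iteratedDeriv (j + 1) (fun t => extChartAt I (c 0) (b t)) 0) := by
    rw [ec, eb]
    exact iteratedDeriv_coeff_sub (A := logCoeff I (c 0)) hp hq (contDiffAt_logCoeff I (c 0)) h
  constructor
  · intro h j hj
    have h1 := hsub j fun i hi => h i (by omega)
    rwa [h (j + 1) hj, sub_self, map_zero, sub_eq_zero] at h1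
  · intro h j
    induction j using Nat.strong_induction_on with
    | _ j ih =>
      intro hj
      rcases j with _ | j
      · simp [h0]
      · have h1 := hsub j fun i hi => ih i (by omega) (by omega)
        rw [h j hj, sub_self] at h1
        exact sub_eq_zero.1 ((bijective_logCoeff I (c 0)).1 (h1.symm.trans (map_zero _).symm))

/-! ### The jet group as the fixed-point subgroup. -/

theorem jetCon_iff (k : ℕ) (c b : SmoothCurve I G) :
    jetCon I G k c b ↔ jetTower I k c = jetTower I k b :=
  (sameJet_iff I k c b).trans (jetTower_eq_iff I k c b).symm

variable (G) in
/-- The injective homomorphism from the jet group to the higher tangent group. -/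
noncomputable def jetGroupHom (k : ℕ) : JetGroup I G k →* HigherTangent I G k :=
  (jetCon I G k).lift (jetTower I k) fun c b h => (jetCon_iff I k c b).1 h

theorem jetGroupHom_jet (k : ℕ) (c : SmoothCurve I G) :
    jetGroupHom G I k (jet I k c) = jetTower I k c := rfl

theorem jetGroupHom_injective (k : ℕ) : Function.Injective (jetGroupHom G I k) := by
  intro x y
  refine Con.induction_on₂ x y fun c b h => ?_
  exact (jetCon I G k).eq.2 ((jetCon_iff I k c b).2 h)

theorem range_jetGroupHom (k : ℕ) : Set.range (jetGroupHom G I k) =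
    MulAction.fixedPoints (Equiv.Perm (Fin k)) (HigherTangent I G k) := by
  refine Set.Subset.antisymm ?_ fun u hu => ?_
  · rintro _ ⟨x, rfl⟩
    refine Con.induction_on x fun c => ?_
    exact jetTower_mem_fixedPoints I k c
  · rw [mem_fixedPoints_iff] at hu
    -- Since `u` is fixed, its coefficient on any one subset of size j + 1 determines the target for
    -- order j; the value 0 for j ≥ k is never used.
    obtain ⟨c, h0, hc⟩ := exists_curve_rightLogDeriv I (rightTriv I G k u).1
      (fun j => if h : j < k then (rightTriv I G k u).2
        (Classical.choose (exists_idxStar_card h)) else 0) k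
    refine ⟨jet I k c, (rightTriv I G k).injective ?_⟩
    rw [jetGroupHom_jet, rightTriv_jetTower, h0]
    refine Prod.ext rfl (funext fun α => ?_)
    have h1 := α.1.card_le_univ
    have h2 := Finset.card_pos.2 α.2
    simp only [Fintype.card_fin] at h1
    have h3 : α.1.card - 1 < k := by omega
    refine (hc _ h3).trans ?_
    refine (dif_pos h3).trans ?_
    refine hu _ _ ?_
    rw [Classical.choose_spec (exists_idxStar_card h3)]
    omega

theorem exists_subgroup_fixedPoints (k : ℕ) :
    ∃ S : Subgroup (HigherTangent I G k),
      (S : Set (HigherTangent I G k)) =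
        MulAction.fixedPoints (Equiv.Perm (Fin k)) (HigherTangent I G k) ∧
      ∃ Φ : S ≃* JetGroup I G k, ∀ (u : S) (c : SmoothCurve I G), Φ u = jet I k c →
        (rightTriv I G k u).1 = c 0 ∧
        ∀ α : IdxStar k, (rightTriv I G k u).2 α =
          iteratedDeriv (α.1.card - 1) (rightLogDeriv I c) 0 := by
  refine ⟨(jetGroupHom G I k).range, ?_, ?_⟩
  · rw [MonoidHom.coe_range]
    exact range_jetGroupHom I k
  let Ψ : JetGroup I G k ≃* (jetGroupHom G I k).range :=
    MonoidHom.ofInjective (jetGroupHom_injective I k)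
  refine ⟨Ψ.symm, fun u c h => ?_⟩
  have h1 : (u : HigherTangent I G k) = jetTower I k c := by
    rw [← jetGroupHom_jet, ← h]
    exact congrArg Subtype.val (Ψ.apply_symm_apply u).symm
  rw [h1, rightTriv_jetTower]
  exact ⟨rfl, fun _ => rfl⟩

end ChartCoefficient

/-! ### The bracket as the obstruction -/

section ZeroSection

variable {E H G : Type u} [NormedAddCommGroup E] [NormedSpace ℝ E] [TopologicalSpace H]
  {I : ModelWithCorners ℝ E H} [TopologicalSpace G] [ChartedSpace H G] [Group G] [LieGroup I ∞ G]

theorem mul_zeroSection (z : TangentBundle I G) (h : G) :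
    z * ⟨h, 0⟩ = tangentMap I I (fun x => x * h) z := by
  have h1 := tangentMap_mul (J := I) (I := I) (f := id) (g := fun _ : G => h)
    mdifferentiable_id mdifferentiable_const z
  have h2 : tangentMap I I (fun _ : G => h) z = ⟨h, 0⟩ := by
    simp only [tangentMap, mfderiv_const]
    rfl
  rw [h2, tangentMap_id] at h1
  exact h1.symm

theorem zeroSection_mul (z : TangentBundle I G) (h : G) :
    (⟨h, 0⟩ : TangentBundle I G) * z = tangentMap I I (fun x => h * x) z := by
  have h1 := tangentMap_mul (J := I) (I := I) (g := id) (f := fun _ : G => h)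
    mdifferentiable_const mdifferentiable_id z
  have h2 : tangentMap I I (fun _ : G => h) z = ⟨h, 0⟩ := by
    simp only [tangentMap, mfderiv_const]
    rfl
  rw [h2, tangentMap_id] at h1
  exact h1.symm

theorem zeroSection_mul_zeroSection (x y : G) :
    (⟨x, 0⟩ * ⟨y, 0⟩ : TangentBundle I G) = ⟨x * y, 0⟩ := by
  rw [mul_zeroSection]
  exact congrArg (Bundle.TotalSpace.mk (x * y)) (map_zero _)

/-- Multiplying by a zero vector on the right is right translation, so this product is already in
right-trivialized form. -/
theorem rightTrivTangent_mul_zeroSection (w : GroupLieAlgebra I G) (h : G) :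
    rightTrivTangent G I (⟨1, w⟩ * ⟨h, 0⟩) = (h, w) := by
  rw [← Equiv.eq_symm_apply, mul_zeroSection]
  exact Bundle.TotalSpace.ext (one_mul h) (heq_of_eq rfl)

theorem rightTrivTangent_mk_one (w : GroupLieAlgebra I G) :
    rightTrivTangent G I ⟨1, w⟩ = (1, w) := by
  have h := rightTrivTangent_mul_zeroSection w (1 : G)
  rwa [← tangentOne_def, mul_one] at h

theorem rightTrivTangent_zeroSection (h : G) :
    rightTrivTangent G I ⟨h, 0⟩ = (h, 0) := by
  have h1 := rightTrivTangent_mul_zeroSection (I := I) 0 h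
  rwa [← tangentOne_def, one_mul] at h1

end ZeroSection

/-! ### Passing a counterexample from T^kG to T^(k+1)G. -/

section Stabilization

variable {E H G : Type u} [NormedAddCommGroup E] [NormedSpace ℝ E] [TopologicalSpace H]
  (I : ModelWithCorners ℝ E H) [TopologicalSpace G] [ChartedSpace H G] [Group G] [LieGroup I ∞ G]

theorem rightTriv_succ_eq (k : ℕ) (u : TangentBundle (tower I G k).I (tower I G k).G) :
    rightTriv I G (k + 1) u =
      ((rightTriv I G k (rightTrivTangent _ _ u).1).1,
        glueStar k ((rightTriv I G k (rightTrivTangent _ _ u).1).2,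
          lieAlgebraSplit I G k (rightTrivTangent _ _ u).2)) := rfl

variable (G) in
/-- The zero section `T^k G → T^{k+1} G`. -/
noncomputable def zeroLift (k : ℕ) : HigherTangent I G k →* HigherTangent I G (k + 1) where
  toFun u := (⟨u, 0⟩ : TangentBundle (tower I G k).I (tower I G k).G)
  map_one' := rfl
  map_mul' u v := (zeroSection_mul_zeroSection (I := (tower I G k).I) u v).symm

theorem zeroLift_injective (k : ℕ) : Function.Injective (zeroLift G I k) := fun _ _ h =>
  congrArg (fun z : TangentBundle (tower I G k).I (tower I G k).G => z.1) h

theorem rightTriv_zeroLift (k : ℕ) (u : HigherTangent I G k) :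
    rightTriv I G (k + 1) (zeroLift G I k u) =
      ((rightTriv I G k u).1, glueStar k ((rightTriv I G k u).2, 0)) := by
  refine (rightTriv_succ_eq I k _).trans ?_
  have h : rightTrivTangent (tower I G k).G (tower I G k).I (zeroLift G I k u) = (u, 0) :=
    rightTrivTangent_zeroSection u
  rw [h, map_zero]

/-- The extension of a permutation of `{1, …, k}` to `{1, …, k+1}` fixing `k+1`. -/
def extendPerm {k : ℕ} (σ : Equiv.Perm (Fin k)) : Equiv.Perm (Fin (k + 1)) :=
  (finSuccEquivLast.trans (Equiv.optionCongr σ)).trans finSuccEquivLast.symm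

theorem extendPerm_castSucc {k : ℕ} (σ : Equiv.Perm (Fin k)) (i : Fin k) :
    extendPerm σ i.castSucc = (σ i).castSucc := by
  simp [extendPerm]

theorem extendPerm_last {k : ℕ} (σ : Equiv.Perm (Fin k)) :
    extendPerm σ (Fin.last k) = Fin.last k := by
  simp [extendPerm]

theorem extendPerm_inv {k : ℕ} (σ : Equiv.Perm (Fin k)) :
    (extendPerm σ)⁻¹ = extendPerm σ⁻¹ := by
  refine inv_eq_of_mul_eq_one_right (Equiv.ext fun i => ?_)
  refine Fin.lastCases ?_ (fun i => ?_) i <;>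
    simp [extendPerm_castSucc, extendPerm_last]

theorem last_mem_map_extendPerm {k : ℕ} (σ : Equiv.Perm (Fin k)) (α : Idx (k + 1)) :
    Fin.last k ∈ α.map (extendPerm σ).toEmbedding ↔ Fin.last k ∈ α := by
  have h := Finset.mem_map' (extendPerm σ).toEmbedding (a := Fin.last k) (s := α)
  rwa [Equiv.coe_toEmbedding, extendPerm_last] at h

theorem down_map_extendPerm {k : ℕ} (σ : Equiv.Perm (Fin k)) (α : Idx (k + 1)) :
    Idx.down (α.map (extendPerm σ).toEmbedding) = α.down.map σ.toEmbedding := by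
  ext i
  obtain ⟨i, rfl⟩ := σ.surjective i
  have h := Finset.mem_map' (extendPerm σ).toEmbedding (a := i.castSucc) (s := α)
  have h' := Finset.mem_map' σ.toEmbedding (a := i) (s := α.down)
  rw [Equiv.coe_toEmbedding] at h h'
  rw [h', Idx.down, Idx.down, Finset.mem_filter, ← extendPerm_castSucc, h]
  simp

/-- The zero section puts 0 on every subset containing the new unit and leaves the other
coefficients alone; the extended permutation preserves both classes of subsets. -/
theorem zeroLift_smul {k : ℕ} (σ : Equiv.Perm (Fin k)) (u : HigherTangent I G k) :
    zeroLift G I k (σ • u) = extendPerm σ • zeroLift G I k u := by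
  apply (rightTriv I G (k + 1)).injective
  rw [rightTriv_smul, rightTriv_zeroLift, rightTriv_zeroLift, rightTriv_smul, permUnits, permUnits,
    extendPerm_inv]
  refine Prod.ext rfl (funext fun α => ?_)
  have h1 := last_mem_map_extendPerm σ⁻¹ α.1
  by_cases h : Fin.last k ∈ α.1
  · refine (dif_pos h).trans (Eq.symm ?_)
    exact dif_pos (h1.2 h)
  · refine (dif_neg h).trans ((dif_neg (mt h1.1 h)).trans ?_).symm
    exact congrArg _ (Subtype.ext (down_map_extendPerm σ⁻¹ α.1))

theorem exists_smul_mul_ne_succ {k : ℕ}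
    (h : ∃ (σ : Equiv.Perm (Fin k)) (u v : HigherTangent I G k), σ • (u * v) ≠ σ • u * σ • v) :
    ∃ (σ : Equiv.Perm (Fin (k + 1))) (u v : HigherTangent I G (k + 1)),
      σ • (u * v) ≠ σ • u * σ • v := by
  obtain ⟨σ, u, v, h⟩ := h
  refine ⟨extendPerm σ, zeroLift G I k u, zeroLift G I k v, fun h' => h ?_⟩
  apply zeroLift_injective
  rw [map_mul, zeroLift_smul, zeroLift_smul, zeroLift_smul, map_mul, h']

end Stabilization

/-! ### The swap of the two units on T²G. -/

section SecondOrder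

variable {E H G : Type u} [NormedAddCommGroup E] [NormedSpace ℝ E] [TopologicalSpace H]
  (I : ModelWithCorners ℝ E H) [TopologicalSpace G] [ChartedSpace H G] [Group G] [LieGroup I ∞ G]

/-- The element `ε₁ X` of `T^2 G`. -/
noncomputable def unitOne (X : GroupLieAlgebra I G) : HigherTangent I G 2 :=
  (⟨(⟨1, X⟩ : TangentBundle I G), (0 : E × E)⟩ : TangentBundle I.tangent (TangentBundle I G))

/-- The element `ε₂ X` of `T^2 G`. -/
noncomputable def unitTwo (X : GroupLieAlgebra I G) : HigherTangent I G 2 :=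
  (⟨(⟨1, 0⟩ : TangentBundle I G), ((X, 0) : E × E)⟩ : TangentBundle I.tangent (TangentBundle I G))

theorem rightTriv_two {u : HigherTangent I G 2} {p : TangentBundle I G} {g : G}
    {x : GroupLieAlgebra I G} {w : E × E}
    (hu : rightTrivTangent (TangentBundle I G) I.tangent u = (p, w))
    (hp : rightTrivTangent G I p = (g, x)) :
    rightTriv I G 2 u = (g, fun α => if 1 ∈ α.1 then if 0 ∈ α.1 then w.2 else w.1 else x) := by
  have h1 : rightTriv I G 1 p = (g, glueStar 0 (fun _ => 0, fun _ => x)) := by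
    refine (rightTriv_succ_eq I 0 p).trans ?_
    have : rightTrivTangent (tower I G 0).G (tower I G 0).I p = (g, x) := hp
    rw [this]
    rfl
  refine (rightTriv_succ_eq I 1 u).trans ?_
  have h2 : rightTrivTangent (tower I G 1).G (tower I G 1).I u = (p, w) := hu
  rw [h2, h1]
  refine Prod.ext rfl (funext fun α => ?_)
  by_cases h : (1 : Fin 2) ∈ α.1
  · refine (dif_pos h).trans ((if_pos h).trans ?_).symm
    have hd : (Fin.last 0 ∈ α.1.down) ↔ (0 : Fin 2) ∈ α.1 := by
      simp [Idx.down]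
    by_cases h0 : (0 : Fin 2) ∈ α.1
    · exact (if_pos h0).trans (if_pos (hd.2 h0)).symm
    · exact (if_neg h0).trans (if_neg (mt hd.1 h0)).symm
  · refine (dif_neg h).trans (Eq.trans ?_ (if_neg h).symm)
    refine dif_pos ?_
    obtain ⟨i, hi⟩ := Idx.down_nonempty h α.2
    rwa [Subsingleton.elim (α := Fin 1) (Fin.last 0) i]

theorem rightTriv_unitTwo_mul_unitOne (X Y : GroupLieAlgebra I G) :
    rightTriv I G 2 (unitTwo I Y * unitOne I X) =
      (1, fun α => if 1 ∈ α.1 then if 0 ∈ α.1 then 0 else Y else X) :=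
  rightTriv_two I (rightTrivTangent_mul_zeroSection (I := I.tangent) (G := TangentBundle I G)
    ((Y, 0) : E × E) ⟨1, X⟩) (rightTrivTangent_mk_one X)

theorem unitOne_zero : unitOne I (0 : GroupLieAlgebra I G) = 1 := rfl

theorem unitTwo_zero : unitTwo I (0 : GroupLieAlgebra I G) = 1 := rfl

theorem swap_smul_unitTwo_mul_unitOne (X Y : GroupLieAlgebra I G) :
    Equiv.swap (0 : Fin 2) 1 • (unitTwo I Y * unitOne I X) = unitTwo I X * unitOne I Y := by
  apply (rightTriv I G 2).injective
  rw [rightTriv_smul, rightTriv_unitTwo_mul_unitOne, rightTriv_unitTwo_mul_unitOne, permUnits,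
    Equiv.swap_inv]
  refine Prod.ext rfl (funext fun α => ?_)
  have h0 : (0 : Fin 2) ∈ (permIdx (Equiv.swap 0 1) α).1 ↔ (1 : Fin 2) ∈ α.1 := by
    have := Finset.mem_map' (Equiv.swap (0 : Fin 2) 1).toEmbedding (a := 1) (s := α.1)
    rwa [Equiv.coe_toEmbedding, Equiv.swap_apply_right] at this
  have h1 : (1 : Fin 2) ∈ (permIdx (Equiv.swap 0 1) α).1 ↔ (0 : Fin 2) ∈ α.1 := by
    have := Finset.mem_map' (Equiv.swap (0 : Fin 2) 1).toEmbedding (a := 0) (s := α.1)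
    rwa [Equiv.coe_toEmbedding, Equiv.swap_apply_left] at this
  obtain ⟨i, hi⟩ := α.2
  have h2 : (0 : Fin 2) ∈ α.1 ∨ (1 : Fin 2) ∈ α.1 := by
    fin_cases i
    · exact Or.inl hi
    · exact Or.inr hi
  simp only [h0, h1]
  by_cases a0 : (0 : Fin 2) ∈ α.1 <;> by_cases a1 : (1 : Fin 2) ∈ α.1 <;> simp_all

/-- The swap exchanges ε₁X with ε₂X and ε₂Y with ε₁Y, so the right side of `h` is ε₂X · ε₁Y, which
is also the swap of ε₂Y · ε₁X. Injectivity of the action then gives commutation. -/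
theorem commute_of_swap_smul_mul {X Y : GroupLieAlgebra I G}
    (h : Equiv.swap (0 : Fin 2) 1 • (unitOne I X * unitTwo I Y) =
      Equiv.swap (0 : Fin 2) 1 • unitOne I X * Equiv.swap (0 : Fin 2) 1 • unitTwo I Y) :
    unitOne I X * unitTwo I Y = unitTwo I Y * unitOne I X := by
  have h1 := swap_smul_unitTwo_mul_unitOne I X 0
  have h2 := swap_smul_unitTwo_mul_unitOne I 0 Y
  rw [unitTwo_zero, unitOne_zero, one_mul, mul_one] at h1
  rw [unitTwo_zero, unitOne_zero, one_mul, mul_one] at h2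
  rw [h1, h2, ← swap_smul_unitTwo_mul_unitOne I X Y] at h
  exact MulAction.injective _ h

end SecondOrder

/-! ### The Lie bracket as a second derivative of the multiplication in a chart. -/

section Bracket

variable {E H G : Type u} [NormedAddCommGroup E] [NormedSpace ℝ E] [TopologicalSpace H]
  (I : ModelWithCorners ℝ E H) [TopologicalSpace G] [ChartedSpace H G] [Group G] [LieGroup I ∞ G]

theorem hasDerivAt_fderiv_line {F F' : Type*} [NormedAddCommGroup F] [NormedSpace ℝ F]
    [NormedAddCommGroup F'] [NormedSpace ℝ F'] {f : F → F'} {z : F} (hf : ContDiffAt ℝ 2 f z)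
    {c : ℝ → F} {y : F} (hc : HasDerivAt c y 0) (hc0 : c 0 = z) (w : F) :
    HasDerivAt (fun s => fderiv ℝ f (c s) w) (fderiv ℝ (fderiv ℝ f) z y w) 0 := by
  have h1 : DifferentiableAt ℝ (fderiv ℝ f) (c 0) :=
    hc0 ▸ (hf.fderiv_right (m := 1) (by norm_num)).differentiableAt (by simp)
  have h2 := (h1.hasFDerivAt.comp_hasDerivAt 0 hc).clm_apply (hasDerivAt_const 0 w)
  simpa [hc0] using h2

variable [I.Boundaryless]

variable (G) in
/-- The multiplication of `G` in the chart around `1`. -/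
noncomputable def mulChart (z : E × E) : E :=
  extChartAt I (1 : G) ((extChartAt I (1 : G)).symm z.1 * (extChartAt I (1 : G)).symm z.2)

variable (G) in
theorem contDiffAt_mulChart :
    ContDiffAt ℝ ∞ (mulChart G I) (extChartAt I (1 : G) 1, extChartAt I (1 : G) 1) := by
  have s := contMDiffAt_extChartAt_symm_self I (1 : G)
  have s1 : ContMDiffAt 𝓘(ℝ, E × E) I ∞ (fun z : E × E => (extChartAt I (1 : G)).symm z.1)
      (extChartAt I (1 : G) 1, extChartAt I (1 : G) 1) :=
    s.comp (extChartAt I (1 : G) 1, extChartAt I (1 : G) 1) contDiff_fst.contDiffAt.contMDiffAt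
  have s2 : ContMDiffAt 𝓘(ℝ, E × E) I ∞ (fun z : E × E => (extChartAt I (1 : G)).symm z.2)
      (extChartAt I (1 : G) 1, extChartAt I (1 : G) 1) :=
    s.comp (extChartAt I (1 : G) 1, extChartAt I (1 : G) 1) contDiff_snd.contDiffAt.contMDiffAt
  exact contDiffAt_extChartAt_comp (s1.mul s2) (by simp)

variable (G) in
theorem differentiableAt_mulChart_eventually :
    ∀ᶠ z in nhds (extChartAt I (1 : G) 1, extChartAt I (1 : G) 1),
      DifferentiableAt ℝ (mulChart G I) z := by
  filter_upwards [((contDiffAt_mulChart G I).of_le two_le_infty).eventually (by simp)] with z hz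
    using hz.differentiableAt (by simp)

variable (G) in
/-- There is a smooth curve through `1` which is a line in the chart. -/
theorem exists_line_curve (X : E) :
    ∃ a : SmoothCurve I G, a 0 = 1 ∧ (∀ᶠ t in nhds (0 : ℝ), a t ∈ (extChartAt I (1 : G)).source) ∧
      ((fun t => extChartAt I (1 : G) (a t)) =ᶠ[nhds 0]
        fun t => extChartAt I (1 : G) 1 + t • X) ∧
      velocity I a 0 = ⟨1, X⟩ := by
  obtain ⟨a, h0, ha⟩ := exists_curve I (1 : G)
    (p := fun t => extChartAt I (1 : G) 1 + t • X)
    (contDiff_const.add (contDiff_id.smul contDiff_const)) (by simp)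
  refine ⟨a, h0, ?_, ha, ?_⟩
  · refine (ContMDiff.continuous a.contMDiff).continuousAt.eventually_mem ?_
    rw [h0]
    exact extChartAt_source_mem_nhds _
  · refine Bundle.TotalSpace.ext h0 (heq_of_eq ?_)
    refine (mfderiv_curve_eq_deriv (a.contMDiff.mdifferentiable (by simp) 0)).trans ?_
    rw [h0, ha.deriv_eq, deriv_const_add]
    exact ((hasDerivAt_id (0 : ℝ)).smul_const X).deriv.trans (one_smul ℝ X)

theorem deriv_extChartAt_mul_right {a : ℝ → G} {X : E} {p : E}
    (ha : ∀ᶠ t in nhds (0 : ℝ), a t ∈ (extChartAt I (1 : G)).source)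
    (haX : (fun t => extChartAt I (1 : G) (a t)) =ᶠ[nhds 0]
      fun t => extChartAt I (1 : G) 1 + t • X)
    (hp : DifferentiableAt ℝ (mulChart G I) (p, extChartAt I (1 : G) 1)) :
    deriv (fun r => extChartAt I (1 : G) ((extChartAt I (1 : G)).symm p * a r)) 0 =
      fderiv ℝ (mulChart G I) (p, extChartAt I (1 : G) 1) (0, X) := by
  have h1 : HasDerivAt (fun r : ℝ => (p, extChartAt I (1 : G) 1 + r • X)) ((0 : E), X) 0 := by
    have := ((hasDerivAt_id (0 : ℝ)).smul_const X).const_add (extChartAt I (1 : G) 1)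
    rw [one_smul] at this
    exact (hasDerivAt_const _ _).prodMk this
  have h2 := HasFDerivAt.comp_hasDerivAt_of_eq (l := mulChart G I) 0 hp.hasFDerivAt h1 (by simp)
  refine (h2.congr_of_eventuallyEq ?_).deriv
  filter_upwards [ha, haX] with r hr hr'
  simp only [Function.comp, mulChart, ← hr', (extChartAt I (1 : G)).left_inv hr]

theorem deriv_extChartAt_mul_left {a : ℝ → G} {X : E} {p : E}
    (ha : ∀ᶠ t in nhds (0 : ℝ), a t ∈ (extChartAt I (1 : G)).source)
    (haX : (fun t => extChartAt I (1 : G) (a t)) =ᶠ[nhds 0]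
      fun t => extChartAt I (1 : G) 1 + t • X)
    (hp : DifferentiableAt ℝ (mulChart G I) (extChartAt I (1 : G) 1, p)) :
    deriv (fun r => extChartAt I (1 : G) (a r * (extChartAt I (1 : G)).symm p)) 0 =
      fderiv ℝ (mulChart G I) (extChartAt I (1 : G) 1, p) (X, 0) := by
  have h1 : HasDerivAt (fun r : ℝ => (extChartAt I (1 : G) 1 + r • X, p)) (X, (0 : E)) 0 := by
    have := ((hasDerivAt_id (0 : ℝ)).smul_const X).const_add (extChartAt I (1 : G) 1)
    rw [one_smul] at this
    exact this.prodMk (hasDerivAt_const _ _)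
  have h2 := HasFDerivAt.comp_hasDerivAt_of_eq (l := mulChart G I) 0 hp.hasFDerivAt h1 (by simp)
  refine (h2.congr_of_eventuallyEq ?_).deriv
  filter_upwards [ha, haX] with r hr hr'
  simp only [Function.comp, mulChart, ← hr', (extChartAt I (1 : G)).left_inv hr]

variable (G) in
/-- The left invariant vector field of `X`, read in the chart around `1`. -/
noncomputable def invariantFieldChart (X : E) : E → E :=
  VectorField.mpullbackWithin 𝓘(ℝ, E) I (extChartAt I (1 : G)).symm
    (mulInvariantVectorField (I := I) (G := G) X) (Set.range I)

-- The left invariant field at p is the velocity of r ↦ p·a(r), with a(0) = 1 and a'(0) = X. In the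
-- chart this is the partial derivative of the multiplication in its second argument, so derivatives
-- of the field become second derivatives of `mulChart`.
variable (G) in
theorem invariantFieldChart_eventuallyEq (X : E) :
    invariantFieldChart G I X =ᶠ[nhds (extChartAt I (1 : G) 1)]
      fun p => fderiv ℝ (mulChart G I) (p, extChartAt I (1 : G) 1) (0, X) := by
  obtain ⟨a, a0, ha, haX, hv⟩ := exists_line_curve G I X
  have hd := (Continuous.prodMk_left (extChartAt I (1 : G) 1)).continuousAt.eventually
    (differentiableAt_mulChart_eventually G I)
  have : IsManifold I 1 G := IsManifold.of_le (n := ∞) (by simp)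
  filter_upwards [hd, extChartAt_target_mem_nhds (I := I) (1 : G)] with p hp hpt
  rw [← deriv_extChartAt_mul_right I ha haX hp]
  have hs : (extChartAt I (1 : G)).symm p ∈ (chartAt H (1 : G)).source := by
    rw [← extChartAt_source I]
    exact (extChartAt I (1 : G)).map_target hpt
  have hinv : (mfderivWithin 𝓘(ℝ, E) I (extChartAt I (1 : G)).symm (Set.range I) p).inverse =
      mfderiv I 𝓘(ℝ, E) (extChartAt I (1 : G)) ((extChartAt I (1 : G)).symm p) :=
    ContinuousLinearMap.inverse_eq
      (mfderivWithin_extChartAt_symm_comp_mfderiv_extChartAt hpt)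
      (mfderiv_extChartAt_comp_mfderivWithin_extChartAt_symm hpt)
  have hc : ContMDiff 𝓘(ℝ, ℝ) I ∞ (fun r => (extChartAt I (1 : G)).symm p * a r) :=
    contMDiff_const.mul a.contMDiff
  have e1 : velocity I (fun r => (extChartAt I (1 : G)).symm p * a r) 0 =
      ⟨(extChartAt I (1 : G)).symm p,
        mulInvariantVectorField X ((extChartAt I (1 : G)).symm p)⟩ := by
    have hl : MDifferentiable I I (fun x : G => (extChartAt I (1 : G)).symm p * x) :=
      (contMDiff_mul_left (n := ∞)).mdifferentiable (by simp)
    have h1 := tangentMap_comp_at (I := 𝓘(ℝ, ℝ)) (I' := I) (I'' := I) (f := a)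
      (g := fun x : G => (extChartAt I (1 : G)).symm p * x) ⟨(0 : ℝ), (1 : ℝ)⟩ (hl _)
      (a.contMDiff.mdifferentiable (by simp) _)
    refine h1.trans ((congrArg _ hv).trans ?_)
    exact Bundle.TotalSpace.ext (mul_one _) (heq_of_eq rfl)
  have e2 := extChartAt_velocity (I := I) (⟨1, 0⟩ : TangentBundle I G)
    (hc.mdifferentiable (by simp) 0) (by simpa [a0] using hs)
  rw [e1, extChartAt_tangent_apply _ _ hs] at e2
  refine Eq.trans ?_ (congrArg Prod.snd e2)
  exact congrArg (fun L : E →L[ℝ] E =>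
    L (mulInvariantVectorField X ((extChartAt I (1 : G)).symm p))) hinv

variable (G) in
theorem fderiv_invariantFieldChart (X Y : E) :
    fderiv ℝ (invariantFieldChart G I X) (extChartAt I (1 : G) 1) Y =
      fderiv ℝ (fderiv ℝ (mulChart G I)) (extChartAt I (1 : G) 1, extChartAt I (1 : G) 1)
        (Y, 0) (0, X) := by
  rw [(invariantFieldChart_eventuallyEq G I X).fderiv_eq]
  have hm : DifferentiableAt ℝ (fderiv ℝ (mulChart G I))
      (extChartAt I (1 : G) 1, extChartAt I (1 : G) 1) :=
    ((contDiffAt_mulChart G I).fderiv_right (m := ∞) (by simp)).differentiableAt (by simp)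
  have h1 : HasFDerivAt (fun p : E => (p, extChartAt I (1 : G) 1))
      (ContinuousLinearMap.inl ℝ E E) (extChartAt I (1 : G) 1) :=
    hasFDerivAt_prodMk_left _ _
  have h2 := (HasFDerivAt.comp (f := fun p : E => (p, extChartAt I (1 : G) 1))
    (extChartAt I (1 : G) 1) hm.hasFDerivAt h1).clm_apply
    (hasFDerivAt_const ((0 : E), X) _)
  refine (congrArg (fun L : E →L[ℝ] E => L Y) h2.fderiv).trans ?_
  simp

variable (G) in
theorem invariantFieldChart_self (X : E) :
    invariantFieldChart G I X (extChartAt I (1 : G) 1) = X := by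
  obtain ⟨a, a0, ha, haX, hv⟩ := exists_line_curve G I X
  rw [(invariantFieldChart_eventuallyEq G I X).eq_of_nhds,
    ← deriv_extChartAt_mul_right I ha haX (differentiableAt_mulChart_eventually G I).self_of_nhds]
  simp only [extChartAt_to_inv, one_mul]
  rw [haX.deriv_eq, deriv_const_add]
  exact ((hasDerivAt_id (0 : ℝ)).smul_const X).deriv.trans (one_smul ℝ X)

variable (G) in
theorem lieBracket_invariantFieldChart (X Y : E) :
    VectorField.lieBracketWithin ℝ (invariantFieldChart G I X) (invariantFieldChart G I Y)
        ((extChartAt I (1 : G)).symm ⁻¹' Set.univ ∩ Set.range I) (extChartAt I (1 : G) 1) =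
      fderiv ℝ (fderiv ℝ (mulChart G I)) (extChartAt I (1 : G) 1, extChartAt I (1 : G) 1)
          (X, 0) (0, Y) -
        fderiv ℝ (fderiv ℝ (mulChart G I)) (extChartAt I (1 : G) 1, extChartAt I (1 : G) 1)
          (Y, 0) (0, X) := by
  rw [I.range_eq_univ, Set.preimage_univ, Set.univ_inter, VectorField.lieBracketWithin_univ,
    VectorField.lieBracket, invariantFieldChart_self, invariantFieldChart_self,
    fderiv_invariantFieldChart, fderiv_invariantFieldChart]

theorem bracket_eq_zero_of_symm {X Y : GroupLieAlgebra I G}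
    (h : fderiv ℝ (fderiv ℝ (mulChart G I)) (extChartAt I (1 : G) 1, extChartAt I (1 : G) 1)
        ((X, 0) : E × E) ((0, Y) : E × E) =
      fderiv ℝ (fderiv ℝ (mulChart G I)) (extChartAt I (1 : G) 1, extChartAt I (1 : G) 1)
        ((Y, 0) : E × E) ((0, X) : E × E)) :
    ⁅X, Y⁆ = 0 := by
  rw [GroupLieAlgebra.bracket_def, VectorField.mlieBracket, VectorField.mlieBracketWithin_apply]
  have h0 := (lieBracket_invariantFieldChart G I X Y).trans (sub_eq_zero.2 h)
  exact (congrArg _ h0).trans (map_zero _)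

-- ε₁X is the velocity of the constant curve (1, X) in TG, and ε₂Y that of the zero-section curve
-- (b(s), 0). The two products are therefore iterated derivatives of a(r)b(s) and b(s)a(r), first in
-- r and then in s.
variable (G) in
theorem mulChart_symm_of_commute {X Y : E}
    (h : unitOne (G := G) I X * unitTwo I Y = unitTwo I Y * unitOne I X) :
    fderiv ℝ (fderiv ℝ (mulChart G I)) (extChartAt I (1 : G) 1, extChartAt I (1 : G) 1)
        (X, 0) (0, Y) =
      fderiv ℝ (fderiv ℝ (mulChart G I)) (extChartAt I (1 : G) 1, extChartAt I (1 : G) 1)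
        (Y, 0) (0, X) := by
  obtain ⟨a, a0, ha, haX, hva⟩ := exists_line_curve G I X
  obtain ⟨b, b0, hb, hbY, hvb⟩ := exists_line_curve G I Y
  have hz : ContMDiff I I.tangent ∞ (fun x : G => (⟨x, 0⟩ : TangentBundle I G)) :=
    Bundle.contMDiff_zeroSection ℝ (TangentSpace I : G → Type _)
  have hzb : ContMDiff 𝓘(ℝ, ℝ) I.tangent ∞ (fun s => (⟨b s, 0⟩ : TangentBundle I G)) :=
    ContMDiff.comp (g := fun x : G => (⟨x, 0⟩ : TangentBundle I G)) (f := b) hz b.contMDiff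
  have hcX : ContMDiff 𝓘(ℝ, ℝ) I.tangent ∞ (fun _ => (⟨1, X⟩ : TangentBundle I G)) :=
    contMDiff_const (I := 𝓘(ℝ, ℝ)) (M := ℝ) (I' := I.tangent) (c := (⟨1, X⟩ : TangentBundle I G))
  have e1 : velocity I.tangent (fun _ => (⟨1, X⟩ : TangentBundle I G)) 0 = unitOne I X := by
    refine Bundle.TotalSpace.ext rfl (heq_of_eq ?_)
    exact congrArg (fun L : ℝ →L[ℝ] E × E => L 1)
      (mfderiv_const : mfderiv 𝓘(ℝ, ℝ) I.tangent
        (fun _ : ℝ => (⟨1, X⟩ : TangentBundle I G)) 0 = 0)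
  have e2 : velocity I.tangent (fun s => (⟨b s, 0⟩ : TangentBundle I G)) 0 = unitTwo I Y := by
    have h1 := tangentMap_comp_at (I := 𝓘(ℝ, ℝ)) (I' := I) (I'' := I.tangent) (f := b)
      (g := fun x : G => (⟨x, 0⟩ : TangentBundle I G)) ⟨(0 : ℝ), (1 : ℝ)⟩
      (hz.mdifferentiable (by simp) _) (b.contMDiff.mdifferentiable (by simp) _)
    refine h1.trans ((congrArg _ hvb).trans ?_)
    exact Bundle.TotalSpace.ext rfl (heq_of_eq (mfderiv_zeroSection_apply 1 Y))
  have m1 (s : ℝ) : (⟨1, X⟩ * ⟨b s, 0⟩ : TangentBundle I G) = velocity I (fun r => a r * b s) 0 := by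
    rw [← hva, mul_zeroSection]
    exact (tangentMap_comp_at (I := 𝓘(ℝ, ℝ)) (I' := I) (I'' := I) (f := a)
      (g := fun x : G => x * b s) ⟨(0 : ℝ), (1 : ℝ)⟩
      ((contMDiff_mul_right (n := ∞)).mdifferentiable (by simp) _)
      (a.contMDiff.mdifferentiable (by simp) _)).symm
  have m2 (s : ℝ) : (⟨b s, 0⟩ * ⟨1, X⟩ : TangentBundle I G) = velocity I (fun r => b s * a r) 0 := by
    rw [← hva, zeroSection_mul]
    exact (tangentMap_comp_at (I := 𝓘(ℝ, ℝ)) (I' := I) (I'' := I) (f := a)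
      (g := fun x : G => b s * x) ⟨(0 : ℝ), (1 : ℝ)⟩
      ((contMDiff_mul_left (n := ∞)).mdifferentiable (by simp) _)
      (a.contMDiff.mdifferentiable (by simp) _)).symm
  have v1 := velocity_mul (hcX.mdifferentiable (by simp)) (hzb.mdifferentiable (by simp)) 0
  have v2 := velocity_mul (hzb.mdifferentiable (by simp)) (hcX.mdifferentiable (by simp)) 0
  have hv : velocity I.tangent (fun s => (⟨1, X⟩ * ⟨b s, 0⟩ : TangentBundle I G)) 0 =
      velocity I.tangent (fun s => (⟨b s, 0⟩ * ⟨1, X⟩ : TangentBundle I G)) 0 := by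
    rw [v1, v2, e1, e2]
    exact h
  -- `P` only selects a chart: both products lie over the chart domain at 1, and comparing them in
  -- this chart gives an equality of s-derivatives in the chart of TG.
  let P : TangentBundle I.tangent (TangentBundle I G) := ⟨⟨1, X⟩, (0 : E × E)⟩
  have hP := congrArg (extChartAt I.tangent.tangent P) hv
  have hl1 : MDifferentiable 𝓘(ℝ, ℝ) I.tangent
      (fun s => (⟨1, X⟩ * ⟨b s, 0⟩ : TangentBundle I G)) :=
    (hcX.mul hzb).mdifferentiable (by simp)
  have hl2 : MDifferentiable 𝓘(ℝ, ℝ) I.tangent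
      (fun s => (⟨b s, 0⟩ * ⟨1, X⟩ : TangentBundle I G)) :=
    (hzb.mul hcX).mdifferentiable (by simp)
  have hab (s : ℝ) : MDifferentiable 𝓘(ℝ, ℝ) I (fun r => a r * b s) :=
    (a.contMDiff.mul contMDiff_const).mdifferentiable (by simp)
  have hba (s : ℝ) : MDifferentiable 𝓘(ℝ, ℝ) I (fun r => b s * a r) :=
    (contMDiff_const.mul a.contMDiff).mdifferentiable (by simp)
  have hs1 : (⟨1, X⟩ * ⟨b 0, 0⟩ : TangentBundle I G).proj ∈ (chartAt H (1 : G)).source := by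
    change 1 * b 0 ∈ _
    simp [b0]
  have hs2 : (⟨b 0, 0⟩ * ⟨1, X⟩ : TangentBundle I G).proj ∈ (chartAt H (1 : G)).source := by
    change b 0 * 1 ∈ _
    simp [b0]
  rw [extChartAt_velocity P (hl1 0) (by simpa [P] using hs1),
    extChartAt_velocity P (hl2 0) (by simpa [P] using hs2)] at hP
  have hP' := congrArg Prod.snd hP
  simp only [m1, m2] at hP'
  have hbs : ∀ᶠ s in nhds (0 : ℝ), b s ∈ (chartAt H (1 : G)).source := by
    simpa only [extChartAt_source] using hb
  have hline : HasDerivAt (fun s : ℝ => extChartAt I (1 : G) 1 + s • Y) Y 0 := by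
    have := ((hasDerivAt_id (0 : ℝ)).smul_const Y).const_add (extChartAt I (1 : G) 1)
    rwa [one_smul] at this
  have hline0 : extChartAt I (1 : G) 1 + (0 : ℝ) • Y = extChartAt I (1 : G) 1 := by simp
  have hdm := differentiableAt_mulChart_eventually G I
  have c1 : (fun s => extChartAt I.tangent (⟨1, X⟩ : TangentBundle I G)
      (velocity I (fun r => a r * b s) 0)) =ᶠ[nhds 0] fun s => (extChartAt I (1 : G) (b s),
        fderiv ℝ (mulChart G I)
          (extChartAt I (1 : G) 1, extChartAt I (1 : G) 1 + s • Y) (X, (0 : E))) := by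
    have hd : ∀ᶠ s in nhds (0 : ℝ), DifferentiableAt ℝ (mulChart G I)
        (extChartAt I (1 : G) 1, extChartAt I (1 : G) 1 + s • Y) :=
      Filter.Tendsto.eventually (l₂ := nhds (extChartAt I (1 : G) 1, extChartAt I (1 : G) 1))
        (f := fun s : ℝ => (extChartAt I (1 : G) 1, extChartAt I (1 : G) 1 + s • Y))
        (by simpa only [hline0] using (continuousAt_const.prodMk hline.continuousAt).tendsto) hdm
    filter_upwards [hbs, hb, hbY, hd] with s h1 h2 h3 h4
    rw [extChartAt_velocity _ (hab s 0)
      (by simpa [a0] using h1), ← h3]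
    rw [← h3] at h4
    rw [← deriv_extChartAt_mul_left I ha haX h4, (extChartAt I (1 : G)).left_inv h2, a0, one_mul]
  have c2 : (fun s => extChartAt I.tangent (⟨1, X⟩ : TangentBundle I G)
      (velocity I (fun r => b s * a r) 0)) =ᶠ[nhds 0] fun s => (extChartAt I (1 : G) (b s),
        fderiv ℝ (mulChart G I)
          (extChartAt I (1 : G) 1 + s • Y, extChartAt I (1 : G) 1) ((0 : E), X)) := by
    have hd : ∀ᶠ s in nhds (0 : ℝ), DifferentiableAt ℝ (mulChart G I)
        (extChartAt I (1 : G) 1 + s • Y, extChartAt I (1 : G) 1) :=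
      Filter.Tendsto.eventually (l₂ := nhds (extChartAt I (1 : G) 1, extChartAt I (1 : G) 1))
        (f := fun s : ℝ => (extChartAt I (1 : G) 1 + s • Y, extChartAt I (1 : G) 1))
        (by simpa only [hline0] using (hline.continuousAt.prodMk continuousAt_const).tendsto) hdm
    filter_upwards [hbs, hb, hbY, hd] with s h1 h2 h3 h4
    rw [extChartAt_velocity _ (hba s 0)
      (by simpa [a0] using h1), ← h3]
    rw [← h3] at h4
    rw [← deriv_extChartAt_mul_right I ha haX h4, (extChartAt I (1 : G)).left_inv h2, a0, mul_one]
  have hm := (contDiffAt_mulChart G I).of_le two_le_infty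
  have hbd : HasDerivAt (fun s => extChartAt I (1 : G) (b s)) Y 0 :=
    hline.congr_of_eventuallyEq hbY
  have d1 := (hbd.prodMk (hasDerivAt_fderiv_line hm ((hasDerivAt_const (0 : ℝ) _).prodMk hline)
    (by simp) (X, (0 : E)))).congr_of_eventuallyEq c1
  have d2 := (hbd.prodMk (hasDerivAt_fderiv_line hm (hline.prodMk (hasDerivAt_const (0 : ℝ) _))
    (by simp) ((0 : E), X))).congr_of_eventuallyEq c2
  have hfin := congrArg Prod.snd ((d1.deriv.symm.trans hP').trans d2.deriv)
  -- The first product yields the second derivative in the order (0, Y), (X, 0); symmetry brings it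
  -- to the order in the goal.
  rw [(hm.isSymmSndFDerivAt (by simp)).eq]
  exact hfin

theorem exists_smul_mul_ne {k : ℕ} (hk : 2 ≤ k) (hb : ∃ X Y : GroupLieAlgebra I G, ⁅X, Y⁆ ≠ 0) :
    ∃ (σ : Equiv.Perm (Fin k)) (u v : HigherTangent I G k), σ • (u * v) ≠ σ • u * σ • v := by
  induction k, hk using Nat.le_induction with
  | base =>
    obtain ⟨X, Y, h⟩ := hb
    exact ⟨Equiv.swap 0 1, unitOne I X, unitTwo I Y, fun h' =>
      h (bracket_eq_zero_of_symm I (mulChart_symm_of_commute G I (commute_of_swap_smul_mul I h')))⟩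
  | succ k _ ih => exact exists_smul_mul_ne_succ I ih

end Bracket
end HigherJets

theorem proposition3p3 {E H G : Type u} [NormedAddCommGroup E] [NormedSpace ℝ E] [CompleteSpace E]
    [TopologicalSpace H] (I : ModelWithCorners ℝ E H) [I.Boundaryless]
    [TopologicalSpace G] [ChartedSpace H G] [Group G] [LieGroup I ∞ G] (k : ℕ) :
    -- the fixed point set is a subgroup, isomorphic to the jet group; in the right
    -- trivializations the isomorphism is given by `x_α = x_{|α|}`
    (∃ S : Subgroup (HigherTangent I G k),
      (S : Set (HigherTangent I G k)) =
        MulAction.fixedPoints (Equiv.Perm (Fin k)) (HigherTangent I G k) ∧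
      ∃ Φ : S ≃* JetGroup I G k, ∀ (u : S) (c : SmoothCurve I G), Φ u = jet I k c →
        (rightTriv I G k u).1 = c 0 ∧
        ∀ α : IdxStar k, (rightTriv I G k u).2 α =
          iteratedDeriv (α.1.card - 1) (rightLogDeriv I c) 0) ∧
    -- the action is in general not by automorphisms
    (2 ≤ k → (∃ X Y : GroupLieAlgebra I G, ⁅X, Y⁆ ≠ 0) →
      ∃ (σ : Equiv.Perm (Fin k)) (u v : HigherTangent I G k), σ • (u * v) ≠ σ • u * σ • v) :=
  ⟨exists_subgroup_fixedPoints I k, exists_smul_mul_ne I⟩
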